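/- Let $m \ge 1$, let $x_1,\dots,x_m \in \mathbb{R}^d$ and $y_1,\dots,y_m \in \{\pm 1\}$, and let $f : \mathbb{R}^d \times \mathbb{R}^p \to \mathbb{R}$, written $f(x;\theta)$. For $F : \mathbb{R}^p \to \mathbb{R}$ let $\partial F(\theta) = \mathrm{conv}\{\lim_k \nabla F(\theta_k) : \theta_k \to \theta,\ F \text{ differentiable at } \theta_k\}$ denote the Clarke subdifferential. An arc is a curve $u : [0,\infty) \to \mathbb{R}^p$ that is absolutely continuous on every compact subinterval, and $F$ admits a chain rule if for every arc $u$ and almost every $t \ge 0$ one has $\frac{d}{dt} F(u(t)) = \langle g, u'(t)\rangle$ for all $g \in \partial F(u(t))$. Let $\|\cdot\|$ be any norm on $\mathbb{R}^p$, with dual norm $\|z\|_\star = \max\{|\langle z, v\rangle| : \|v\| = 1\}$. Let $L > 0$ be a real number and $\mathcal{L}(\theta) = \sum_{i=1}^m e^{-y_i f(x_i;\theta)}$ the exponential loss. Let $t \mapsto \theta_t$, $t \ge 0$, be a steepest flow for $\mathcal{L}$ with respect to $\|\cdot\|$, that is, an arc such that for almost every $t \ge 0$ $$\frac{d\theta_t}{dt}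 \in \Big\{ \operatorname*{arg\,min}_{\|u\| \le \|g\|_\star} \langle u, g\rangle : g \in \partial \mathcal{L}(\theta_t) \Big\}.$$ Assume: (A1) for every $i$, $f(x_i;\cdot)$ is locally Lipschitz and admits a chain rule; (A2) for every $i$, $f(x_i; c\theta) = c^L f(x_i;\theta)$ for all $c > 0$ and $\theta \in \mathbb{R}^p$; (A3) there is $t_0 > 0$ with $\mathcal{L}(\theta_{t_0}) < 1$. Then for every limit point $\bar\theta$ of $\theta_t / \|\theta_t\|$ as $t \to \infty$ there is $c > 0$ such that $\theta^\ast = c\bar\theta$ is a KKT point of the problem $$\min_{\theta \in \mathbb{R}^p} \tfrac12 \|\theta\|^2 \quad \text{subject to} \quad y_i f(x_i;\theta) \ge 1 \ \text{ for all } i = 1, \dots, m,$$ that is, $y_i f(x_i;\theta^\ast) \ge 1$ for all $i$, and there are $\lambda_1,\dots,\lambda_m \ge 0$ such that $0 \in \partial\big(\tfrac12 \|\cdot\|^2\big)(\theta^\ast) + \sum_{i=1}^m \lambda_i\, \partial\big(1 - y_i f(x_i;\cdot)\big)(\theta^\ast)$ (a sum of sets) and $\lambda_i \big(1 - y_i f(x_i;\theta^\ast)\big)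 = 0$ for all $i$. -/

import Mathlib

open Filter Topology MeasureTheory

namespace SteepestFlow

/-- The space `ℝᵖ` with its standard inner product. -/
abbrev Vec (p : ℕ) : Type := EuclideanSpace ℝ (Fin p)

/-- The Clarke subdifferential of `F` at `θ`: the convex hull of the limits of gradients of `F`
along sequences of points of differentiability that converge to `θ`. -/
noncomputable def clarkeSubdiff {p : ℕ} (F : Vec p → ℝ) (θ : Vec p) : Set (Vec p) :=
  convexHull ℝ {g | ∃ u : ℕ → Vec p, Tendsto u atTop (𝓝 θ) ∧
    (∀ k, DifferentiableAt ℝ F (u k)) ∧ Tendsto (fun k => gradient F (u k)) atTop (𝓝 g)}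

/-- An arc: a curve on `[0, ∞)` that is absolutely continuous on every compact subinterval.
The values at negative times play no role. -/
def IsArc {p : ℕ} (u : ℝ → Vec p) : Prop :=
  ∀ T : ℝ, 0 ≤ T → AbsolutelyContinuousOnInterval u 0 T

/-- `F` admits a chain rule: along every arc `u`, for almost every `t ≥ 0`, one has
`d F(u(t)) / dt = ⟨g, u'(t)⟩` for all `g` in the Clarke subdifferential of `F` at `u(t)`. -/
def AdmitsChainRule {p : ℕ} (F : Vec p → ℝ) : Prop :=
  ∀ u : ℝ → Vec p, IsArc u → ∀ᵐ t : ℝ, 0 ≤ t →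
    ∀ g ∈ clarkeSubdiff F (u t), HasDerivAt (fun s => F (u s)) (inner ℝ g (deriv u t)) t

/-- Positive homogeneity of degree `L`. -/
def IsHomogeneousOfDegree {p : ℕ} (L : ℝ) (F : Vec p → ℝ) : Prop :=
  ∀ (c : ℝ) (θ : Vec p), 0 < c → F (c • θ) = c ^ L * F θ

/-- The dual norm `‖z‖⋆ = max {|⟨z, v⟩| : ‖v‖ = 1}` of a norm `N`. -/
noncomputable def dualNorm {p : ℕ} (N : Seminorm ℝ (Vec p)) (z : Vec p) : ℝ :=
  sSup ((fun v => |inner ℝ z v|) '' {v | N v = 1})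

/-- The steepest descent directions for `g`: the minimizers of `⟨u, g⟩` over all `u` with
`‖u‖ ≤ ‖g‖⋆`. -/
def steepestDirections {p : ℕ} (N : Seminorm ℝ (Vec p)) (g : Vec p) : Set (Vec p) :=
  {u | N u ≤ dualNorm N g ∧ ∀ w : Vec p, N w ≤ dualNorm N g → inner ℝ u g ≤ inner ℝ w g}

/-- `θ` is a steepest flow on `Loss` with respect to the norm `N`: an arc whose velocity is, at
almost every time `t ≥ 0`, a steepest descent direction for some Clarke subgradient. -/
def IsSteepestFlow {p : ℕ} (N : Seminorm ℝ (Vec p)) (Loss : Vec p → ℝ) (θ : ℝ → Vec p) : Prop :=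
  IsArc θ ∧ ∀ᵐ t : ℝ, 0 ≤ t → ∃ v : Vec p, HasDerivAt θ v t ∧
    ∃ g ∈ clarkeSubdiff Loss (θ t), v ∈ steepestDirections N g

/-- The exponential loss `∑ᵢ exp (- yᵢ f(xᵢ; θ))` of the dataset `(xᵢ, yᵢ)`. -/
noncomputable def expLoss {d p m : ℕ} (f : Vec d → Vec p → ℝ) (x : Fin m → Vec d)
    (y : Fin m → ℝ) (θ : Vec p) : ℝ :=
  ∑ i, Real.exp (-(y i * f (x i) θ))

/-- `θ` is a Karush-Kuhn-Tucker point of the problem of minimizing `½ ‖θ‖²`, with `‖·‖` the norm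
`N`, subject to `yᵢ f(xᵢ; θ) ≥ 1` for all `i`. Stationarity says that `0` belongs to the Minkowski
sum of `∂ (½ ‖·‖²)(θ)` and the sets `λᵢ ∂ (1 - yᵢ f(xᵢ; ·))(θ)`. -/
def IsKKTPoint {d p m : ℕ} (N : Seminorm ℝ (Vec p)) (f : Vec d → Vec p → ℝ) (x : Fin m → Vec d)
    (y : Fin m → ℝ) (θ : Vec p) : Prop :=
  (∀ i, 1 ≤ y i * f (x i) θ) ∧
  ∃ lam : Fin m → ℝ, (∀ i, 0 ≤ lam i) ∧
    (∃ k ∈ clarkeSubdiff (fun w => (1 / 2 : ℝ) * N w ^ 2) θ,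
      ∃ h : Fin m → Vec p, (∀ i, h i ∈ clarkeSubdiff (fun w => 1 - y i * f (x i) w) θ) ∧
        k + ∑ i, lam i • h i = 0) ∧
    ∀ i, lam i * (1 - y i * f (x i) θ) = 0

end SteepestFlow

open SteepestFlow

namespace SteepestFlow

open scoped Pointwise

/-! Write `G i` for the margins `y i * f (x i)`, `S` for the dual norm of the subgradient driving
the flow, `ρ` for `N (θ t)`, and `R = ∑ exp (-G i) * G i`. The chain rule makes the loss decay at
rate `S ^ 2`. Euler's identity pairs the negative subgradient with `θ t` to give `L * R`, so the
ratio `κ = S * ρ / (L * R)` is at least 1, with equality exactly when that subgradient norms `θ t`.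

The smoothed margin `-log loss / ρ ^ L` has logarithmic derivative at least `L * (S / ρ) * (κ - 1)`
almost everywhere (`ae_le_deriv_logMargin`). It therefore increases, and it is bounded above by
homogeneity. The loss then tends to 0 and `ρ` to infinity, so `S / ρ` has infinite integral while
`(S / ρ) * (κ - 1)` has a finite one. After any late time at which the direction is close to a limit
point, a window in which `S / ρ` has integral `η` contains a time with `κ < 1 + η`, and the
direction moves by at most `2 * η` in that window (`exists_aligned_time`).

At such times the normalized subgradient nearly norms the direction, which is approximate
stationarity with bounded multipliers (`exists_approximate_multipliers`). Compactness and the closed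
graph of the Clarke subdifferential give exact stationarity in the limit. Complementary slackness
survives because the exponential weights of non-minimal margins vanish as `ρ` grows
(`exists_multipliers`). Homogeneity rescales the direction to a feasible point. -/

/-! ### Compactness of convex hulls in finite dimension. -/

theorem isCompact_convexHull_of_isCompact {E : Type*} [NormedAddCommGroup E] [NormedSpace ℝ E]
    [FiniteDimensional ℝ E] {s : Set E} (hs : IsCompact s) : IsCompact (convexHull ℝ s) := by
  -- Carathéodory: at most `finrank + 1` points suffice, so the hull is a finite union of continuous
  -- images of compact sets.
  have key : convexHull ℝ s = ⋃ k ∈ Finset.range (Module.finrank ℝ E + 2),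
      (fun q : (Fin k → ℝ) × (Fin k → E) => ∑ i, q.1 i • q.2 i) ''
        (stdSimplex ℝ (Fin k) ×ˢ Set.univ.pi fun _ => s) := by
    apply Set.Subset.antisymm
    · intro x hx
      obtain ⟨ι, hι, z, w, hz, haff, hw, hsum, hx⟩ := eq_pos_convex_span_of_mem_convexHull hx
      simp only [Set.mem_iUnion]
      have hcard := haff.card_le_finrank_succ
      have hle := Submodule.finrank_le (vectorSpan ℝ (Set.range z))
      refine ⟨Fintype.card ι, Finset.mem_range.2 (by omega), ?_⟩
      let e := (Fintype.equivFin ι).symm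
      refine ⟨(w ∘ e, z ∘ e), ⟨⟨fun i => (hw _).le, ?_⟩, fun i _ => hz ⟨_, rfl⟩⟩, ?_⟩
      · rw [← hsum]; exact e.sum_comp w
      · rw [← hx]; exact e.sum_comp fun i => w i • z i
    · simp only [Set.iUnion_subset_iff]
      rintro k - _ ⟨q, ⟨⟨h0, h1⟩, hq⟩, rfl⟩
      exact (convex_convexHull ℝ s).sum_mem (fun i _ => h0 i) h1
        fun i _ => subset_convexHull ℝ s (hq i trivial)
  rw [key]
  refine Finset.isCompact_biUnion _ fun k _ => ?_
  have hpi : IsCompact (Set.univ.pi fun _ : Fin k => s) := isCompact_univ_pi fun _ => hs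
  have hcont : Continuous fun q : (Fin k → ℝ) × (Fin k → E) => ∑ i, q.1 i • q.2 i := by fun_prop
  exact ((isCompact_stdSimplex ℝ (Fin k)).prod hpi).image hcont

/-! ### Absolutely continuous functions on an interval -/

theorem _root_.AbsolutelyContinuousOnInterval.lipschitz_comp {X Y : Type*}
    [SeminormedAddCommGroup X] [PseudoMetricSpace Y] {u : ℝ → X} {a b : ℝ} (hu : AbsolutelyContinuousOnInterval u a b)
    {G : X → Y} (hG : LocallyLipschitzOn (u '' Set.uIcc a b) G) :
    AbsolutelyContinuousOnInterval (fun t => G (u t)) a b := by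
  have hc : IsCompact (u '' Set.uIcc a b) := isCompact_uIcc.image_of_continuousOn hu.continuousOn
  obtain ⟨K, hK⟩ := hG.exists_lipschitzOnWith_of_compact hc
  rw [absolutelyContinuousOnInterval_iff] at hu ⊢
  intro ε hε
  have hK0 : (0 : ℝ) < K + 1 := by positivity
  obtain ⟨δ, hδ, h⟩ := hu (ε / (K + 1)) (by positivity)
  refine ⟨δ, hδ, fun E hE hlt => ?_⟩
  have h1 := h E hE hlt
  rw [lt_div_iff₀ hK0] at h1
  refine lt_of_le_of_lt ?_ h1
  rw [Finset.sum_mul]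
  refine Finset.sum_le_sum fun i hi => ?_
  have hm := hE.1 i hi
  refine (hK.dist_le_mul _ ⟨_, hm.1, rfl⟩ _ ⟨_, hm.2, rfl⟩).trans ?_
  have := dist_nonneg (x := u (E.2 i).1) (y := u (E.2 i).2)
  nlinarith

theorem _root_.AbsolutelyContinuousOnInterval.contDiffAt_comp {u : ℝ → ℝ} {a b : ℝ}
    (hu : AbsolutelyContinuousOnInterval u a b) {G : ℝ → ℝ}
    (hG : ∀ t ∈ Set.uIcc a b, ContDiffAt ℝ 1 G (u t)) :
    AbsolutelyContinuousOnInterval (fun t => G (u t)) a b := by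
  apply AbsolutelyContinuousOnInterval.lipschitz_comp hu
  rintro _ ⟨t, ht, rfl⟩
  obtain ⟨K, s, hs, hK⟩ := (hG t ht).exists_lipschitzOnWith
  exact ⟨K, s, mem_nhdsWithin_of_mem_nhds hs, hK⟩

theorem _root_.AbsolutelyContinuousOnInterval.integral_le_sub {φ c : ℝ → ℝ} {a b : ℝ} (hab : a ≤ b)
    (hφ : AbsolutelyContinuousOnInterval φ a b) (hc : IntervalIntegrable c volume a b)
    (h : ∀ᵐ t, t ∈ Set.Icc a b → c t ≤ deriv φ t) : ∫ t in a..b, c t ≤ φ b - φ a := by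
  rw [← hφ.integral_deriv_eq_sub]
  refine intervalIntegral.integral_mono_ae_restrict hab hc hφ.intervalIntegrable_deriv ?_
  exact (ae_restrict_iff' measurableSet_Icc).2 h

theorem _root_.AbsolutelyContinuousOnInterval.sub_le_integral {φ c : ℝ → ℝ} {a b : ℝ} (hab : a ≤ b)
    (hφ : AbsolutelyContinuousOnInterval φ a b) (hc : IntervalIntegrable c volume a b)
    (h : ∀ᵐ t, t ∈ Set.Icc a b → deriv φ t ≤ c t) : φ b - φ a ≤ ∫ t in a..b, c t := by
  rw [← hφ.integral_deriv_eq_sub]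
  refine intervalIntegral.integral_mono_ae_restrict hab hφ.intervalIntegrable_deriv hc ?_
  exact (ae_restrict_iff' measurableSet_Icc).2 h

theorem _root_.AbsolutelyContinuousOnInterval.sub_le_mul {φ : ℝ → ℝ} {a b c : ℝ} (hab : a ≤ b)
    (hφ : AbsolutelyContinuousOnInterval φ a b)
    (h : ∀ᵐ t, t ∈ Set.Icc a b → deriv φ t ≤ c) : φ b - φ a ≤ (b - a) * c := by
  simpa using AbsolutelyContinuousOnInterval.sub_le_integral hab hφ intervalIntegrable_const h

/-! ### Limits of gradients and the Clarke subdifferential -/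

variable {p : ℕ}

theorem _root_.HasGradientAt.hasDerivAt_comp {F : Vec p → ℝ} {g v : Vec p} {u : ℝ → Vec p} {t : ℝ}
    (hF : HasGradientAt F g (u t)) (hu : HasDerivAt u v t) :
    HasDerivAt (fun s => F (u s)) (inner ℝ g v) t := by
  have := (hasGradientAt_iff_hasFDerivAt.1 hF).comp_hasDerivAt t hu
  simpa [Function.comp_def] using this

/-- The limits of gradients of `F` along sequences of points of differentiability. -/
def limitingGradients (F : Vec p → ℝ) (θ : Vec p) : Set (Vec p) :=
  {g | ∃ u : ℕ → Vec p, Tendsto u atTop (𝓝 θ) ∧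
    (∀ k, DifferentiableAt ℝ F (u k)) ∧ Tendsto (fun k => gradient F (u k)) atTop (𝓝 g)}

theorem convex_clarkeSubdiff (F : Vec p → ℝ) (θ : Vec p) : Convex ℝ (clarkeSubdiff F θ) :=
  convex_convexHull ℝ _

/-- Limiting gradients form the fibres of the closed graph of the gradient. Closedness and upper
semicontinuity are read off from this form. -/
theorem mem_limitingGradients_iff {F : Vec p → ℝ} {θ g : Vec p} :
    g ∈ limitingGradients F θ ↔
      (θ, g) ∈ closure {q : Vec p × Vec p | DifferentiableAt ℝ F q.1 ∧ gradient F q.1 = q.2} := by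
  rw [mem_closure_iff_seq_limit]
  constructor
  · rintro ⟨u, hu, hd, hg⟩
    exact ⟨fun k => (u k, gradient F (u k)), fun k => ⟨hd k, rfl⟩, hu.prodMk_nhds hg⟩
  · rintro ⟨q, hq, hlim⟩
    refine ⟨fun k => (q k).1, (continuous_fst.tendsto _).comp hlim, fun k => (hq k).1, ?_⟩
    have := (continuous_snd.tendsto _).comp hlim
    refine this.congr fun k => ?_
    simp [(hq k).2]

theorem gradient_mem_limitingGradients {F : Vec p → ℝ} {θ : Vec p} (h : DifferentiableAt ℝ F θ) :
    gradient F θ ∈ limitingGradients F θ :=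
  mem_limitingGradients_iff.2 (subset_closure ⟨h, rfl⟩)

theorem isClosed_limitingGradients (F : Vec p → ℝ) (θ : Vec p) :
    IsClosed (limitingGradients F θ) := by
  have : limitingGradients F θ = (fun g => (θ, g)) ⁻¹'
      closure {q : Vec p × Vec p | DifferentiableAt ℝ F q.1 ∧ gradient F q.1 = q.2} := by
    ext g; exact mem_limitingGradients_iff
  rw [this]
  exact isClosed_closure.preimage (by fun_prop)

theorem exists_eventually_limitingGradients_subset {F : Vec p → ℝ} (hF : LocallyLipschitz F)
    (θ : Vec p) :
    ∃ K : ℝ, ∀ᶠ u in 𝓝 θ, limitingGradients F u ⊆ Metric.closedBall 0 K := by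
  obtain ⟨K, s, hs, hK⟩ := hF θ
  refine ⟨K, ?_⟩
  filter_upwards [eventually_eventually_nhds.2 hs] with u hu
  rintro g ⟨w, hw, hd, hg⟩
  have hmem : ∀ᶠ k in atTop, gradient F (w k) ∈ Metric.closedBall (0 : Vec p) K := by
    filter_upwards [hw.eventually (eventually_eventually_nhds.2 hu)] with k hk
    have := norm_fderiv_le_of_lipschitzOn ℝ hk hK
    simpa [gradient] using this
  exact Metric.isClosed_closedBall.mem_of_tendsto hg hmem

theorem isCompact_limitingGradients {F : Vec p → ℝ} (hF : LocallyLipschitz F) (θ : Vec p) :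
    IsCompact (limitingGradients F θ) := by
  obtain ⟨K, hK⟩ := exists_eventually_limitingGradients_subset hF θ
  exact (isCompact_closedBall 0 K).of_isClosed_subset (isClosed_limitingGradients F θ)
    hK.self_of_nhds

theorem isCompact_clarkeSubdiff {F : Vec p → ℝ} (hF : LocallyLipschitz F) (θ : Vec p) :
    IsCompact (clarkeSubdiff F θ) :=
  isCompact_convexHull_of_isCompact (isCompact_limitingGradients hF θ)

theorem exists_eventually_clarkeSubdiff_subset {F : Vec p → ℝ} (hF : LocallyLipschitz F)
    (θ : Vec p) : ∃ K : ℝ, ∀ᶠ u in 𝓝 θ, clarkeSubdiff F u ⊆ Metric.closedBall 0 K := by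
  obtain ⟨K, hK⟩ := exists_eventually_limitingGradients_subset hF θ
  refine ⟨K, hK.mono fun u hu => convexHull_min hu (convex_closedBall 0 K)⟩

/-- Upper semicontinuity. Near `θ` all limiting gradients lie in one ball; the part of the ball
outside `U` is compact and avoided at `θ`, and the closed graph keeps it avoided nearby. -/
theorem eventually_limitingGradients_subset {F : Vec p → ℝ} (hF : LocallyLipschitz F)
    (θ : Vec p) {U : Set (Vec p)} (hU : IsOpen U) (h : limitingGradients F θ ⊆ U) :
    ∀ᶠ u in 𝓝 θ, limitingGradients F u ⊆ U := by
  obtain ⟨K, hK⟩ := exists_eventually_limitingGradients_subset hF θ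
  have hc : IsCompact (Metric.closedBall (0 : Vec p) K \ U) := (isCompact_closedBall 0 K).diff hU
  have := hc.eventually_forall_of_forall_eventually (x₀ := θ)
    (P := fun u g => g ∉ limitingGradients F u) (by
      rintro g ⟨-, hg⟩
      have hn : (θ, g) ∉ closure {q : Vec p × Vec p | DifferentiableAt ℝ F q.1 ∧
          gradient F q.1 = q.2} := fun hmem => hg (h (mem_limitingGradients_iff.2 hmem))
      filter_upwards [isClosed_closure.isOpen_compl.mem_nhds hn] with z hz hz'
      exact hz (mem_limitingGradients_iff.1 hz'))
  filter_upwards [hK, this] with u hu hu' g hg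
  by_contra hgU
  exact hu' g ⟨hu hg, hgU⟩ hg

/-- The graph of the Clarke subdifferential is closed. -/
theorem mem_clarkeSubdiff_of_tendsto {F : Vec p → ℝ} (hF : LocallyLipschitz F) {ι : Type*}
    {l : Filter ι} [l.NeBot] {u h : ι → Vec p} {θ g : Vec p} (hu : Tendsto u l (𝓝 θ))
    (hh : Tendsto h l (𝓝 g)) (hmem : ∀ k, h k ∈ clarkeSubdiff F (u k)) :
    g ∈ clarkeSubdiff F θ := by
  have hclosed := (isCompact_clarkeSubdiff hF θ).isClosed
  rw [← hclosed.closure_eq, Metric.closure_eq_iInter_cthickening]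
  simp only [Set.mem_iInter]
  intro ε hε
  -- Thickenings of a convex set are convex, so upper semicontinuity passes from limiting gradients
  -- to their hulls.
  have hsub : limitingGradients F θ ⊆ Metric.thickening ε (clarkeSubdiff F θ) :=
    (subset_convexHull ℝ _).trans (Metric.self_subset_thickening hε _)
  refine Metric.isClosed_cthickening.mem_of_tendsto hh ?_
  filter_upwards [hu.eventually (eventually_limitingGradients_subset hF θ
    Metric.isOpen_thickening hsub)] with k hk
  exact Metric.thickening_subset_cthickening _ _
    (convexHull_min hk ((convex_clarkeSubdiff F θ).thickening ε) (hmem k))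

/-- Rademacher's theorem on each set of a countable cover by sets where `F` is Lipschitz. -/
theorem _root_.LocallyLipschitz.ae_differentiableAt {F : Vec p → ℝ} (hF : LocallyLipschitz F) :
    ∀ᵐ u : Vec p, DifferentiableAt ℝ F u := by
  choose K s hs hK using hF
  obtain ⟨c, hc, hcov⟩ := TopologicalSpace.countable_cover_nhds
    (f := fun x => interior (s x)) fun x => interior_mem_nhds.2 (hs x)
  have : ∀ᵐ u : Vec p, ∀ x ∈ c, u ∈ s x → DifferentiableWithinAt ℝ F (s x) u :=
    (ae_ball_iff hc).2 fun x _ => (hK x).ae_differentiableWithinAt_of_mem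
  filter_upwards [this] with u hu
  have hmem : u ∈ ⋃ x ∈ c, interior (s x) := hcov ▸ Set.mem_univ u
  simp only [Set.mem_iUnion] at hmem
  obtain ⟨x, hx, hux⟩ := hmem
  exact (hu x hx (interior_subset hux)).differentiableAt (mem_interior_iff_mem_nhds.1 hux)

theorem clarkeSubdiff_nonempty {F : Vec p → ℝ} (hF : LocallyLipschitz F) (θ : Vec p) :
    (clarkeSubdiff F θ).Nonempty := by
  have hd : Dense {u : Vec p | DifferentiableAt ℝ F u} :=
    Measure.dense_of_ae (LocallyLipschitz.ae_differentiableAt hF)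
  obtain ⟨K, hK⟩ := exists_eventually_limitingGradients_subset hF θ
  obtain ⟨u, hu, hlim⟩ := mem_closure_iff_seq_limit.1 (hd θ)
  have hev : ∀ᶠ k in atTop, gradient F (u k) ∈ Metric.closedBall (0 : Vec p) K :=
    (hlim.eventually hK).mono fun k hk => hk (gradient_mem_limitingGradients (hu k))
  obtain ⟨g, -, φ, hφ, hg⟩ := (isCompact_closedBall (0 : Vec p) K).tendsto_subseq' hev.frequently
  exact ⟨g, subset_convexHull ℝ _ ⟨u ∘ φ, hlim.comp hφ.tendsto_atTop, fun k => hu _, hg⟩⟩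

/-- The increments of `F` near `θ` are controlled by the support function of its Clarke
subdifferential. -/
theorem exists_forall_sub_le_of_clarkeSubdiff {F : Vec p → ℝ} (hF : LocallyLipschitz F)
    {θ v : Vec p} {c : ℝ} (h : ∀ g ∈ clarkeSubdiff F θ, inner ℝ g v < c) :
    ∃ δ > 0, ∀ u ∈ Metric.ball θ δ, ∀ t ∈ Set.Icc 0 δ, F (u + t • v) - F u ≤ t * c := by
  have hU : IsOpen {g : Vec p | inner ℝ g v < c} :=
    isOpen_lt (by fun_prop) continuous_const
  have hev := eventually_limitingGradients_subset hF θ hU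
    fun g hg => h g (subset_convexHull ℝ _ hg)
  obtain ⟨r, hr, hball⟩ := Metric.eventually_nhds_iff_ball.1 hev
  -- With this `δ`, a point within `δ` of `θ` moved by at most `δ` along `v` stays within `r / 2` of
  -- `θ`.
  set δ := r / (2 * (1 + ‖v‖)) with hδ
  have hv : 0 < 1 + ‖v‖ := by positivity
  have hδ0 : 0 < δ := by positivity
  have hδr : δ * (1 + ‖v‖) < r := by
    have : δ * (1 + ‖v‖) = r / 2 := by rw [hδ]; field_simp
    linarith
  have hin : ∀ u ∈ Metric.ball θ δ, ∀ t ∈ Set.Icc 0 δ, u + t • v ∈ Metric.ball θ r := by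
    intro u hu t ht
    rw [Metric.mem_ball, dist_eq_norm] at hu ⊢
    have : u + t • v - θ = (u - θ) + t • v := by abel
    rw [this]
    refine (norm_add_le _ _).trans_lt ?_
    rw [norm_smul, Real.norm_of_nonneg ht.1]
    have := mul_le_mul_of_nonneg_right ht.2 (norm_nonneg v)
    nlinarith
  -- Fubini: the line in direction `v` through almost every base point meets the
  -- non-differentiability set in measure zero. The increment is bounded along such lines by
  -- integrating the derivative; density and continuity reach every base point.
  have hae : ∀ᵐ u : Vec p, ∀ᵐ t : ℝ, DifferentiableAt ℝ F (u + t • v) :=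
    (ae_ae_add_linearMap_mem_iff (LinearMap.toSpanSingleton ℝ (Vec p) v) volume volume
      (measurableSet_of_differentiableAt ℝ F)).2 (LocallyLipschitz.ae_differentiableAt hF)
  have hdense := Measure.dense_of_ae hae
  refine ⟨δ, hδ0, fun u hu t ht => ?_⟩
  have hne : (𝓝[{u : Vec p | ∀ᵐ t : ℝ, DifferentiableAt ℝ F (u + t • v)}] u).NeBot :=
    mem_closure_iff_nhdsWithin_neBot.1 (hdense u)
  have hcont : Continuous fun w => F (w + t • v) - F w :=
    (hF.continuous.comp (by fun_prop)).sub hF.continuous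
  refine le_of_tendsto ((hcont.tendsto u).mono_left
    (nhdsWithin_le_nhds (s := {u : Vec p | ∀ᵐ t : ℝ, DifferentiableAt ℝ F (u + t • v)}))) ?_
  filter_upwards [self_mem_nhdsWithin, mem_nhdsWithin_of_mem_nhds (Metric.isOpen_ball.mem_nhds hu)]
    with w hw hwball
  have hline : LocallyLipschitz fun s : ℝ => w + s • v :=
    ContDiff.locallyLipschitz (𝕂 := ℝ) (by fun_prop)
  have hac : AbsolutelyContinuousOnInterval (fun s : ℝ => F (w + s • v)) 0 t := by
    obtain ⟨K, hK⟩ := ((hF.comp hline).locallyLipschitzOn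
      (s := Set.uIcc 0 t)).exists_lipschitzOnWith_of_compact isCompact_uIcc
    exact hK.absolutelyContinuousOnInterval
  have := AbsolutelyContinuousOnInterval.sub_le_mul (c := c) ht.1 hac (by
    filter_upwards [hw] with s hs hst
    have hd : HasDerivAt (fun s : ℝ => w + s • v) v s := by
      simpa using ((hasDerivAt_id s).smul_const v).const_add w
    rw [(HasGradientAt.hasDerivAt_comp hs.hasGradientAt hd).deriv]
    exact le_of_lt (hball _ (hin w hwball s ⟨hst.1, hst.2.trans ht.2⟩)
      (gradient_mem_limitingGradients hs)))
  simpa using this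

/-- Converse of `exists_forall_sub_le_of_clarkeSubdiff`: difference quotients bound gradients near
`θ`, and a half-space is closed and convex. Together the two lemmas let inclusions of
subdifferentials be proved on increments. -/
theorem inner_le_of_forall_sub_le {F : Vec p → ℝ} {θ v : Vec p} {c δ : ℝ} (hδ : 0 < δ)
    (h : ∀ u ∈ Metric.ball θ δ, ∀ t ∈ Set.Icc 0 δ, F (u + t • v) - F u ≤ t * c) :
    ∀ g ∈ clarkeSubdiff F θ, inner ℝ g v ≤ c := by
  have hconv : Convex ℝ {g : Vec p | inner ℝ g v ≤ c} := by
    have : {g : Vec p | inner ℝ g v ≤ c} = {g | innerSL ℝ v g ≤ c} := by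
      ext g; simp [real_inner_comm]
    rw [this]
    exact convex_halfSpace_le (innerSL ℝ v).isLinear c
  refine fun g hg => convexHull_min ?_ hconv hg
  rintro g ⟨u, hu, hd, hlim⟩
  have hlim' : Tendsto (fun k => inner ℝ (gradient F (u k)) v) atTop (𝓝 (inner ℝ g v)) :=
    hlim.inner tendsto_const_nhds
  refine le_of_tendsto hlim' ?_
  filter_upwards [hu.eventually (Metric.ball_mem_nhds θ hδ)] with k hk
  have hdv : HasDerivAt (fun s : ℝ => u k + s • v) v 0 := by
    simpa using ((hasDerivAt_id (0 : ℝ)).smul_const v).const_add (u k)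
  have hgr : HasGradientAt F (gradient F (u k)) (u k + (0 : ℝ) • v) := by
    simpa using (hd k).hasGradientAt
  have hder := HasGradientAt.hasDerivAt_comp (u := fun s : ℝ => u k + s • v) hgr hdv
  have hslope := (hasDerivAt_iff_tendsto_slope.1 hder).mono_left (nhdsGT_le_nhdsNE 0)
  refine le_of_tendsto hslope ?_
  filter_upwards [Ioc_mem_nhdsGT hδ] with t ht
  have := h (u k) hk t ⟨ht.1.le, ht.2⟩
  rw [slope_def_field]
  simp only [zero_smul, add_zero, sub_zero]
  rw [div_le_iff₀ ht.1]
  linarith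

/-! ### Separation arguments and the sum rule. -/

theorem exists_separating_direction {s : Set (Vec p)} (hs : Convex ℝ s) (hc : IsClosed s)
    {g : Vec p} (hg : g ∉ s) : ∃ (v : Vec p) (c : ℝ), (∀ h ∈ s, inner ℝ h v < c) ∧
      c < inner ℝ g v := by
  obtain ⟨f, c, h1, h2⟩ := geometric_hahn_banach_closed_point hs hc hg
  refine ⟨(InnerProductSpace.toDual ℝ (Vec p)).symm f, c, fun h hh => ?_, ?_⟩
  · rw [real_inner_comm, InnerProductSpace.toDual_symm_apply]; exact h1 h hh
  · rw [real_inner_comm, InnerProductSpace.toDual_symm_apply]; exact h2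

/-- If a direction strictly separated `z` from the subdifferential, the increments of `F` along it
would be too small for the subgradient inequality. -/
theorem mem_clarkeSubdiff_of_subgradient {F : Vec p → ℝ} (hF : LocallyLipschitz F)
    {θ z : Vec p} (h : ∀ w, F θ + inner ℝ z (w - θ) ≤ F w) : z ∈ clarkeSubdiff F θ := by
  by_contra hz
  obtain ⟨v, c, h1, h2⟩ := exists_separating_direction (convex_clarkeSubdiff F θ)
    (isCompact_clarkeSubdiff hF θ).isClosed hz
  obtain ⟨δ, hδ, hle⟩ := exists_forall_sub_le_of_clarkeSubdiff hF h1
  have h3 := hle θ (Metric.mem_ball_self hδ) δ ⟨hδ.le, le_rfl⟩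
  have h4 := h (θ + δ • v)
  rw [add_sub_cancel_left, inner_smul_right] at h4
  nlinarith

theorem _root_.LocallyLipschitz.add_real {X : Type*} [PseudoEMetricSpace X] {F G : X → ℝ}
    (hF : LocallyLipschitz F) (hG : LocallyLipschitz G) : LocallyLipschitz fun x => F x + G x :=
  (ContDiff.locallyLipschitz (𝕂 := ℝ) (f := fun q : ℝ × ℝ => q.1 + q.2) (by fun_prop)).comp
    (hF.prodMk hG)

theorem _root_.LocallyLipschitz.finset_sum {X ι : Type*} [PseudoEMetricSpace X] (s : Finset ι)
    {F : ι → X → ℝ} (hF : ∀ i, LocallyLipschitz (F i)) :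
    LocallyLipschitz fun x => ∑ i ∈ s, F i x := by
  classical
  induction s using Finset.induction_on with
  | empty => simpa using LocallyLipschitz.const (0 : ℝ)
  | insert i s hi ih =>
    simp only [Finset.sum_insert hi]
    exact LocallyLipschitz.add_real (hF i) ih

/-- A separating direction bounds the sum of the two support functions strictly below its pairing
with `g`, whereas adding the increment bounds for `F` and `G` bounds that pairing. The gap `ε` is
shared equally between them. -/
theorem exists_add_of_mem_clarkeSubdiff_add {F G : Vec p → ℝ} (hF : LocallyLipschitz F)
    (hG : LocallyLipschitz G) {θ g : Vec p} (hg : g ∈ clarkeSubdiff (fun w => F w + G w) θ) :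
    ∃ a ∈ clarkeSubdiff F θ, ∃ b ∈ clarkeSubdiff G θ, g = a + b := by
  by_contra hcon
  have hmem : g ∉ clarkeSubdiff F θ + clarkeSubdiff G θ := by
    rintro ⟨a, ha, b, hb, hab⟩
    exact hcon ⟨a, ha, b, hb, hab.symm⟩
  have hcF := isCompact_clarkeSubdiff hF θ
  have hcG := isCompact_clarkeSubdiff hG θ
  obtain ⟨v, c, h1, h2⟩ := exists_separating_direction
    ((convex_clarkeSubdiff F θ).add (convex_clarkeSubdiff G θ)) (hcF.add hcG).isClosed hmem
  have hcont : Continuous fun h : Vec p => (inner ℝ h v : ℝ) := by fun_prop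
  obtain ⟨a, ha, hamax⟩ := hcF.exists_isMaxOn (clarkeSubdiff_nonempty hF θ) hcont.continuousOn
  obtain ⟨b, hb, hbmax⟩ := hcG.exists_isMaxOn (clarkeSubdiff_nonempty hG θ) hcont.continuousOn
  have hab := h1 (a + b) (Set.add_mem_add ha hb)
  rw [inner_add_left] at hab
  set ε := c - (inner ℝ a v + inner ℝ b v) with hε
  have hε0 : 0 < ε := by linarith
  obtain ⟨δ₁, hδ₁, hle₁⟩ := exists_forall_sub_le_of_clarkeSubdiff hF (c := inner ℝ a v + ε / 2)
    fun h hh => lt_of_le_of_lt (hamax hh) (by linarith)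
  obtain ⟨δ₂, hδ₂, hle₂⟩ := exists_forall_sub_le_of_clarkeSubdiff hG (c := inner ℝ b v + ε / 2)
    fun h hh => lt_of_le_of_lt (hbmax hh) (by linarith)
  have := inner_le_of_forall_sub_le (F := fun w => F w + G w) (θ := θ) (v := v) (c := c)
    (lt_min hδ₁ hδ₂) (fun u hu t ht => by
      have e1 := hle₁ u (Metric.ball_subset_ball (min_le_left _ _) hu) t
        ⟨ht.1, ht.2.trans (min_le_left _ _)⟩
      have e2 := hle₂ u (Metric.ball_subset_ball (min_le_right _ _) hu) t
        ⟨ht.1, ht.2.trans (min_le_right _ _)⟩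
      have : c = (inner ℝ a v + ε / 2) + (inner ℝ b v + ε / 2) := by rw [hε]; ring
      rw [this, mul_add]
      linarith) g hg
  linarith

theorem clarkeSubdiff_const (c : ℝ) (θ : Vec p) {g : Vec p}
    (hg : g ∈ clarkeSubdiff (fun _ => c) θ) : g = 0 := by
  refine convexHull_min ?_ (convex_singleton (0 : Vec p)) hg
  rintro g ⟨u, -, -, hlim⟩
  have : (fun k => gradient (fun _ : Vec p => c) (u k)) = fun _ => 0 := by
    ext1 k; simp [gradient]
  rw [this] at hlim
  exact tendsto_nhds_unique hlim tendsto_const_nhds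

/-- The sum rule for the Clarke subdifferential. -/
theorem exists_sum_of_mem_clarkeSubdiff_sum {ι : Type*} (s : Finset ι) {F : ι → Vec p → ℝ}
    (hF : ∀ i, LocallyLipschitz (F i)) {θ g : Vec p}
    (hg : g ∈ clarkeSubdiff (fun w => ∑ i ∈ s, F i w) θ) :
    ∃ h : ι → Vec p, (∀ i ∈ s, h i ∈ clarkeSubdiff (F i) θ) ∧ g = ∑ i ∈ s, h i := by
  classical
  induction s using Finset.induction_on generalizing g with
  | empty =>
    simp only [Finset.sum_empty] at hg
    exact ⟨fun _ => 0, by simp, by simpa using clarkeSubdiff_const 0 θ hg⟩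
  | insert i s hi ih =>
    simp only [Finset.sum_insert hi] at hg
    obtain ⟨a, ha, b, hb, rfl⟩ :=
      exists_add_of_mem_clarkeSubdiff_add (hF i) (LocallyLipschitz.finset_sum s hF) hg
    obtain ⟨h, hh, rfl⟩ := ih hb
    refine ⟨Function.update h i a, ?_, ?_⟩
    · intro j hj
      rcases Finset.mem_insert.1 hj with rfl | hj
      · simpa using ha
      · rw [Function.update_of_ne (ne_of_mem_of_not_mem hj hi)]; exact hh j hj
    · rw [Finset.sum_insert hi, Function.update_self]
      congr 1
      refine Finset.sum_congr rfl fun j hj => ?_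
      rw [Function.update_of_ne (ne_of_mem_of_not_mem hj hi)]

/-! ### Rescaling of subgradients and Euler's identity. -/

/-- Transfer of Clarke subgradients along a change of variables that rescales gradients. -/
theorem exists_smul_of_gradient_eq {F f : Vec p → ℝ} {φ : Vec p → Vec p} {a : Vec p → ℝ}
    {θ g : Vec p} (hφ : ContinuousAt φ θ) (ha : ContinuousAt a θ) (ha0 : a θ ≠ 0)
    (h : ∀ u, DifferentiableAt ℝ F u → DifferentiableAt ℝ f (φ u) ∧
      gradient F u = a u • gradient f (φ u))
    (hg : g ∈ clarkeSubdiff F θ) : ∃ h ∈ clarkeSubdiff f (φ θ), g = a θ • h := by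
  have hsub : limitingGradients F θ ⊆ a θ • clarkeSubdiff f (φ θ) := by
    rintro g ⟨u, hu, hd, hlim⟩
    refine ⟨(a θ)⁻¹ • g, subset_convexHull ℝ _ ⟨fun k => φ (u k), hφ.tendsto.comp hu,
      fun k => (h _ (hd k)).1, ?_⟩, by simp [smul_smul, ha0]⟩
    have hau : Tendsto (fun k => a (u k)) atTop (𝓝 (a θ)) := ha.tendsto.comp hu
    refine ((hau.inv₀ ha0).smul hlim).congr' ?_
    filter_upwards [hau.eventually_ne ha0] with k hk
    rw [(h _ (hd k)).2, smul_smul, inv_mul_cancel₀ hk, one_smul]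
  obtain ⟨h, hh, e⟩ := convexHull_min hsub ((convex_clarkeSubdiff f (φ θ)).smul (a θ)) hg
  exact ⟨h, hh, e.symm⟩

/-- One formula serves the exponential of a margin, the homogeneity scaling and affine changes of a
function. -/
theorem hasGradientAt_comp_smul {f : Vec p → ℝ} {ψ : ℝ → ℝ} {ψ' c : ℝ} {u : Vec p}
    (hf : DifferentiableAt ℝ f (c • u)) (hψ : HasDerivAt ψ ψ' (f (c • u))) :
    HasGradientAt (fun w => ψ (f (c • w))) ((ψ' * c) • gradient f (c • u)) u := by
  rw [hasGradientAt_iff_hasFDerivAt]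
  have h1 : HasFDerivAt (fun w : Vec p => c • w) (c • ContinuousLinearMap.id ℝ (Vec p)) u :=
    (hasFDerivAt_id u).const_smul c
  have h2 := hasGradientAt_iff_hasFDerivAt.1 hf.hasGradientAt
  have h3 := hψ.comp_hasFDerivAt u (h2.comp u h1)
  have e : (InnerProductSpace.toDual ℝ (Vec p)) ((ψ' * c) • gradient f (c • u)) =
      ψ' • ((InnerProductSpace.toDual ℝ (Vec p)) (gradient f (c • u))).comp
        (c • ContinuousLinearMap.id ℝ (Vec p)) := by
    ext w
    simp [mul_assoc]
  rw [e]
  exact h3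

/-- Euler's identity for Clarke subgradients of a positively homogeneous function. -/
theorem inner_clarkeSubdiff_of_homogeneous {f : Vec p → ℝ} {L : ℝ}
    (hf : LocallyLipschitz f) (hhom : IsHomogeneousOfDegree L f) {θ g : Vec p}
    (hg : g ∈ clarkeSubdiff f θ) : inner ℝ g θ = L * f θ := by
  have hconv : Convex ℝ {g : Vec p | inner ℝ g θ = L * f θ} := by
    have : {g : Vec p | inner ℝ g θ = L * f θ} = {g | innerSL ℝ θ g = L * f θ} := by
      ext g; simp [real_inner_comm]
    rw [this]
    exact convex_hyperplane (innerSL ℝ θ).isLinear _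
  refine convexHull_min ?_ hconv hg
  rintro g ⟨u, hu, hd, hlim⟩
  -- Differentiate `c ↦ f (c • u k)` at `c = 1`, once by the chain rule and once by homogeneity.
  have key : ∀ k, inner ℝ (gradient f (u k)) (u k) = L * f (u k) := by
    intro k
    have h1 : HasDerivAt (fun c : ℝ => c • u k) (u k) 1 := by
      simpa using (hasDerivAt_id (1 : ℝ)).smul_const (u k)
    have h2 := HasGradientAt.hasDerivAt_comp (u := fun c : ℝ => c • u k) (F := f)
      (g := gradient f (u k)) (by simpa using (hd k).hasGradientAt) h1
    have h3 : HasDerivAt (fun c : ℝ => c ^ L * f (u k)) (L * f (u k)) 1 := by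
      simpa using (Real.hasDerivAt_rpow_const (x := 1) (p := L) (Or.inl one_ne_zero)).mul_const
        (f (u k))
    refine h2.unique (h3.congr_of_eventuallyEq ?_)
    filter_upwards [lt_mem_nhds (zero_lt_one' ℝ)] with c hc
    exact hhom c (u k) hc
  have l1 : Tendsto (fun k => inner ℝ (gradient f (u k)) (u k)) atTop (𝓝 (inner ℝ g θ)) :=
    hlim.inner hu
  have l2 : Tendsto (fun k => L * f (u k)) atTop (𝓝 (L * f θ)) :=
    ((hf.continuous.tendsto θ).comp hu).const_mul L
  exact tendsto_nhds_unique (l1.congr key) l2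

variable {m : ℕ}

/-! ### Norms on `ℝᵖ` -/

theorem locallyLipschitz_seminorm (N : Seminorm ℝ (Vec p)) : LocallyLipschitz N :=
  ConvexOn.locallyLipschitz N.convexOn

theorem exists_pos_mul_norm_le {N : Seminorm ℝ (Vec p)} (hN : ∀ w, N w = 0 → w = 0) :
    ∃ c > 0, ∀ w, c * ‖w‖ ≤ N w := by
  by_cases hne : (Metric.sphere (0 : Vec p) 1).Nonempty
  · obtain ⟨w₀, hw₀, hmin⟩ := (isCompact_sphere (0 : Vec p) 1).exists_isMinOn hne
      (locallyLipschitz_seminorm N).continuous.continuousOn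
    have hw₀' : w₀ ≠ 0 := by rintro rfl; simp at hw₀
    refine ⟨N w₀, lt_of_le_of_ne (apply_nonneg N _) fun h => hw₀' (hN _ h.symm), fun w => ?_⟩
    rcases eq_or_ne w 0 with rfl | hw
    · simp
    · have hmem : ‖w‖⁻¹ • w ∈ Metric.sphere (0 : Vec p) 1 := by
        simp [norm_smul, norm_ne_zero_iff.2 hw]
      have h1 : N w₀ ≤ N (‖w‖⁻¹ • w) := hmin hmem
      rw [map_smul_eq_mul, norm_inv, norm_norm, inv_mul_eq_div, le_div_iff₀ (norm_pos_iff.2 hw)]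
        at h1
      exact h1
  -- The unit sphere is empty only for `p = 0`, where every vector vanishes.
  · refine ⟨1, one_pos, fun w => ?_⟩
    have hw : w = 0 := by
      by_contra hw
      exact hne ⟨‖w‖⁻¹ • w, by simp [norm_smul, norm_ne_zero_iff.2 hw]⟩
    simp [hw]

theorem isCompact_seminorm_sphere {N : Seminorm ℝ (Vec p)} (hN : ∀ w, N w = 0 → w = 0) :
    IsCompact {w : Vec p | N w = 1} := by
  obtain ⟨c, hc, hle⟩ := exists_pos_mul_norm_le hN
  refine (isCompact_closedBall (0 : Vec p) c⁻¹).of_isClosed_subset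
    (isClosed_eq (locallyLipschitz_seminorm N).continuous continuous_const) fun w hw => ?_
  have hw1 : N w = 1 := hw
  have := hle w
  rw [hw1] at this
  rw [mem_closedBall_zero_iff, ← one_div, le_div_iff₀ hc]
  linarith

theorem dualNorm_nonneg (N : Seminorm ℝ (Vec p)) (z : Vec p) : 0 ≤ dualNorm N z := by
  refine Real.sSup_nonneg ?_
  rintro _ ⟨v, -, rfl⟩
  exact abs_nonneg _

theorem abs_inner_le_dualNorm_mul {N : Seminorm ℝ (Vec p)} (hN : ∀ w, N w = 0 → w = 0)
    (z w : Vec p) : |inner ℝ z w| ≤ dualNorm N z * N w := by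
  rcases eq_or_ne w 0 with rfl | hw
  · simp
  have hpos : 0 < N w := lt_of_le_of_ne (apply_nonneg N _) fun h => hw (hN _ h.symm)
  have hbdd : BddAbove ((fun v => |inner ℝ z v|) '' {v | N v = 1}) :=
    ((isCompact_seminorm_sphere hN).image (by fun_prop)).bddAbove
  have hmem : (N w)⁻¹ • w ∈ {v : Vec p | N v = 1} := by
    simp [map_smul_eq_mul, abs_of_pos hpos, hpos.ne']
  have h1 : |inner ℝ z ((N w)⁻¹ • w)| ≤ dualNorm N z := le_csSup hbdd ⟨_, hmem, rfl⟩
  rw [inner_smul_right, abs_mul, abs_inv, abs_of_pos hpos, inv_mul_eq_div,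
    div_le_iff₀ hpos] at h1
  exact h1

/-- The duality inequality bounds the pairing below. Comparing `v` with both signs of `dualNorm N g
• w`, for `N w = 1`, bounds it above. -/
theorem inner_eq_of_mem_steepestDirections {N : Seminorm ℝ (Vec p)}
    (hN : ∀ w, N w = 0 → w = 0) {g v : Vec p} (hv : v ∈ steepestDirections N g) :
    inner ℝ g v = -(dualNorm N g) ^ 2 := by
  obtain ⟨hv1, hv2⟩ := hv
  have hν := dualNorm_nonneg N g
  have habs := abs_inner_le_dualNorm_mul hN g v
  have hmul := mul_le_mul_of_nonneg_left hv1 hν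
  have hlow := neg_abs_le (inner ℝ g v)
  refine le_antisymm ?_ (by nlinarith)
  rcases hν.eq_or_lt with h0 | hpos
  · rw [← h0, zero_mul] at habs
    have := le_abs_self (inner ℝ g v)
    rw [← h0]; linarith
  have hle : dualNorm N g ≤ -inner ℝ g v / dualNorm N g := by
    -- An empty unit sphere would give the default supremum 0, contrary to `hpos`.
    have hne : ((fun v => |inner ℝ g v|) '' {v : Vec p | N v = 1}).Nonempty := by
      by_contra hcon
      rw [Set.not_nonempty_iff_eq_empty] at hcon
      rw [dualNorm, hcon, Real.sSup_empty] at hpos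
      exact lt_irrefl _ hpos
    refine csSup_le hne ?_
    rintro _ ⟨w, hw, rfl⟩
    have hw : N w = 1 := hw
    simp only
    rw [le_div_iff₀ hpos]
    have h1 := hv2 (dualNorm N g • w) (by simp [map_smul_eq_mul, hw, abs_of_pos hpos])
    have h2 := hv2 ((-dualNorm N g) • w) (by
      rw [map_smul_eq_mul, hw, norm_neg, Real.norm_of_nonneg hν, mul_one])
    rw [real_inner_comm g v, inner_smul_left, real_inner_comm g w] at h1 h2
    simp only [conj_trivial] at h1 h2
    rcases abs_cases (inner ℝ g w) with ⟨h, -⟩ | ⟨h, -⟩ <;> rw [h] <;> nlinarith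
  rw [le_div_iff₀ hpos] at hle
  nlinarith

/-- The reverse triangle inequality on difference quotients; no differentiability of `N` itself is
needed. -/
theorem abs_deriv_seminorm_comp_le {N : Seminorm ℝ (Vec p)} {w : ℝ → Vec p} {v : Vec p} {t r : ℝ}
    (hw : HasDerivAt w v t) (hr : HasDerivAt (fun s => N (w s)) r t) : |r| ≤ N v := by
  have h1 := (hasDerivAt_iff_tendsto_slope.1 hr).abs
  have h2 := ((locallyLipschitz_seminorm N).continuous.tendsto v).comp
    (hasDerivAt_iff_tendsto_slope.1 hw)
  refine le_of_tendsto_of_tendsto' h1 h2 fun s => ?_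
  simp only [slope, vsub_eq_sub, Function.comp_apply, smul_eq_mul, map_smul_eq_mul, abs_mul,
    Real.norm_eq_abs]
  exact mul_le_mul_of_nonneg_left (abs_sub_map_le_sub N _ _) (abs_nonneg _)

/-! ### The flow in terms of the margins -/

/-- The exponential loss of the margins `G i`. -/
noncomputable def marginLoss (G : Fin m → Vec p → ℝ) (w : Vec p) : ℝ :=
  ∑ i, Real.exp (-(G i w))

/-- A steepest flow on the exponential loss of homogeneous margins that separates the data at
time `t₀`. -/
structure IsSeparatingFlow (N : Seminorm ℝ (Vec p)) (L : ℝ) (G : Fin m → Vec p → ℝ)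
    (θ : ℝ → Vec p) (t₀ : ℝ) : Prop where
  nonempty : 0 < m
  definite : ∀ w, N w = 0 → w = 0
  degree_pos : 0 < L
  lipschitz : ∀ i, LocallyLipschitz (G i)
  chainRule : ∀ i, AdmitsChainRule (G i)
  homogeneous : ∀ i, IsHomogeneousOfDegree L (G i)
  flow : IsSteepestFlow N (marginLoss G) θ
  time_nonneg : 0 ≤ t₀
  loss_lt : marginLoss G (θ t₀) < 1

theorem locallyLipschitz_marginLoss {G : Fin m → Vec p → ℝ} (hG : ∀ i, LocallyLipschitz (G i)) :
    LocallyLipschitz (marginLoss G) := by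
  refine LocallyLipschitz.finset_sum Finset.univ (F := fun i w => Real.exp (-(G i w))) fun i => ?_
  exact (ContDiff.locallyLipschitz (𝕂 := ℝ) (f := fun r : ℝ => Real.exp (-r)) (by fun_prop)).comp
    (hG i)

theorem exists_of_mem_clarkeSubdiff_exp_neg {G : Vec p → ℝ} (hG : LocallyLipschitz G)
    {θ g : Vec p} (hg : g ∈ clarkeSubdiff (fun w => Real.exp (-(G w))) θ) :
    ∃ h ∈ clarkeSubdiff G θ, g = -Real.exp (-(G θ)) • h := by
  refine exists_smul_of_gradient_eq (φ := fun u => u) (a := fun u => -Real.exp (-(G u)))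
    continuousAt_id ?_ (neg_ne_zero.2 (Real.exp_pos _).ne') (fun u hu => ?_) hg
  · exact (Real.continuous_exp.comp hG.continuous.neg).neg.continuousAt
  · have hd : DifferentiableAt ℝ G u := by
      have h1 := (hu.log (Real.exp_pos _).ne').neg
      refine h1.congr_of_eventuallyEq (Eventually.of_forall fun w => ?_)
      simp
    refine ⟨hd, ?_⟩
    have h2 : HasDerivAt (fun r : ℝ => Real.exp (-r)) (-Real.exp (-(G u))) (G ((1 : ℝ) • u)) := by
      simpa using (hasDerivAt_neg (G u)).exp
    have h3 := hasGradientAt_comp_smul (f := G) (c := 1) (u := u) (by simpa using hd) h2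
    simpa using h3.gradient

/-- The speed of the flow in the norm `N`, read off from the decay of the loss. -/
noncomputable def speed (G : Fin m → Vec p → ℝ) (θ : ℝ → Vec p) (t : ℝ) : ℝ :=
  √(-deriv (fun s => marginLoss G (θ s)) t)

/-- The negative gradient of the margin loss for given subgradients of the margins. -/
noncomputable def negGrad (G : Fin m → Vec p → ℝ) (h : Fin m → Vec p) (w : Vec p) : Vec p :=
  ∑ i, Real.exp (-(G i w)) • h i

/-- The weighted sum of the margins. -/
noncomputable def weightedMargin (G : Fin m → Vec p → ℝ) (w : Vec p) : ℝ :=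
  ∑ i, Real.exp (-(G i w)) * G i w

/-- The logarithm of the smoothed margin. -/
noncomputable def logMargin (N : Seminorm ℝ (Vec p)) (L : ℝ) (G : Fin m → Vec p → ℝ)
    (θ : ℝ → Vec p) (t : ℝ) : ℝ :=
  Real.log (-Real.log (marginLoss G (θ t))) - L * Real.log (N (θ t))

theorem speed_nonneg (G : Fin m → Vec p → ℝ) (θ : ℝ → Vec p) (t : ℝ) : 0 ≤ speed G θ t :=
  Real.sqrt_nonneg _

theorem inner_negGrad {G : Fin m → Vec p → ℝ} {L : ℝ} (hG : ∀ i, LocallyLipschitz (G i))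
    (hhom : ∀ i, IsHomogeneousOfDegree L (G i)) {h : Fin m → Vec p} {w : Vec p}
    (hh : ∀ i, h i ∈ clarkeSubdiff (G i) w) :
    inner ℝ (negGrad G h w) w = L * weightedMargin G w := by
  rw [negGrad, sum_inner, weightedMargin, Finset.mul_sum]
  refine Finset.sum_congr rfl fun i _ => ?_
  rw [inner_smul_left, inner_clarkeSubdiff_of_homogeneous (hG i) (hhom i) (hh i)]
  simp; ring

/-- `-log loss` is a soft minimum of the margins and lies below each of them. -/
theorem neg_log_marginLoss_le {G : Fin m → Vec p → ℝ} {w : Vec p} (i : Fin m) :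
    -Real.log (marginLoss G w) ≤ G i w := by
  have h1 : Real.exp (-(G i w)) ≤ marginLoss G w :=
    Finset.single_le_sum (f := fun i => Real.exp (-(G i w))) (fun _ _ => (Real.exp_pos _).le)
      (Finset.mem_univ i)
  have := Real.log_le_log (Real.exp_pos _) h1
  rw [Real.log_exp] at this
  linarith

theorem marginLoss_mul_le (G : Fin m → Vec p → ℝ) (w : Vec p) :
    marginLoss G w * -Real.log (marginLoss G w) ≤ weightedMargin G w := by
  rw [weightedMargin]
  nth_rewrite 1 [marginLoss]
  rw [Finset.sum_mul]
  exact Finset.sum_le_sum fun i _ =>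
    mul_le_mul_of_nonneg_left (neg_log_marginLoss_le i) (Real.exp_pos _).le

/-! ### Energy decay and monotonicity of the smoothed margin. -/

namespace IsSeparatingFlow

variable {N : Seminorm ℝ (Vec p)} {L : ℝ} {G : Fin m → Vec p → ℝ} {θ : ℝ → Vec p} {t₀ : ℝ}

/-- The sum rule splits the driving subgradient `g` into margin subgradients `h i`. The chain rule
holds for every choice of subgradients, hence for these, so the loss has derivative `⟨g, v⟩ = -‖g‖⋆
^ 2`. Thus `speed` equals the dual norm of whichever `g` drives the flow. -/
theorem ae_velocity (H : IsSeparatingFlow N L G θ t₀) :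
    ∀ᵐ t : ℝ, 0 ≤ t → ∃ (v : Vec p) (h : Fin m → Vec p), HasDerivAt θ v t ∧
      N v ≤ speed G θ t ∧ (∀ i, h i ∈ clarkeSubdiff (G i) (θ t)) ∧
      (∀ w, |inner ℝ (negGrad G h (θ t)) w| ≤ speed G θ t * N w) ∧
      HasDerivAt (fun s => marginLoss G (θ s)) (-(speed G θ t) ^ 2) t := by
  have hch : ∀ᵐ t : ℝ, ∀ i, 0 ≤ t → ∀ g ∈ clarkeSubdiff (G i) (θ t),
      HasDerivAt (fun s => G i (θ s)) (inner ℝ g (deriv θ t)) t :=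
    ae_all_iff.2 fun i => H.chainRule i θ H.flow.1
  filter_upwards [H.flow.2, hch] with t ht hct ht0
  obtain ⟨v, hv, g, hg, hst⟩ := ht ht0
  obtain ⟨e, he, hge⟩ := exists_sum_of_mem_clarkeSubdiff_sum Finset.univ
    (F := fun i w => Real.exp (-(G i w))) (fun i =>
      (ContDiff.locallyLipschitz (𝕂 := ℝ) (f := fun r : ℝ => Real.exp (-r))
        (by fun_prop)).comp (H.lipschitz i)) hg
  choose h hh heq using fun i =>
    exists_of_mem_clarkeSubdiff_exp_neg (H.lipschitz i) (he i (Finset.mem_univ i))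
  have hneg : g = -negGrad G h (θ t) := by
    rw [hge, negGrad, ← Finset.sum_neg_distrib]
    exact Finset.sum_congr rfl fun i _ => by rw [heq i, neg_smul]
  have hinner := inner_eq_of_mem_steepestDirections H.definite hst
  have hder : HasDerivAt (fun s => marginLoss G (θ s)) (-(dualNorm N g) ^ 2) t := by
    have h1 : HasDerivAt (fun s => ∑ i, Real.exp (-(G i (θ s))))
        (∑ i, Real.exp (-(G i (θ t))) * -(inner ℝ (h i) (deriv θ t))) t :=
      HasDerivAt.fun_sum fun i _ => (hct i ht0 (h i) (hh i)).neg.exp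
    have e1 : ∑ i, Real.exp (-(G i (θ t))) * -(inner ℝ (h i) (deriv θ t)) =
        -(dualNorm N g) ^ 2 := by
      rw [← hinner, hneg, inner_neg_left, negGrad, sum_inner, ← Finset.sum_neg_distrib, hv.deriv]
      refine Finset.sum_congr rfl fun i _ => ?_
      rw [inner_smul_left]; simp
    rw [e1] at h1
    exact h1
  have hs : speed G θ t = dualNorm N g := by
    rw [speed, hder.deriv, neg_neg, Real.sqrt_sq (dualNorm_nonneg N g)]
  rw [hs]
  refine ⟨v, h, hv, hst.1, hh, fun w => ?_, hder⟩
  have := abs_inner_le_dualNorm_mul H.definite g w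
  nth_rewrite 1 [hneg] at this
  rwa [inner_neg_left, abs_neg] at this

theorem absolutelyContinuous (H : IsSeparatingFlow N L G θ t₀) {a b : ℝ} (ha : 0 ≤ a)
    (hab : a ≤ b) : AbsolutelyContinuousOnInterval θ a b := by
  refine (H.flow.1 b (ha.trans hab)).mono ?_
  rw [Set.uIcc_of_le hab, Set.uIcc_of_le (ha.trans hab)]
  exact Set.Icc_subset_Icc_left ha

theorem loss_absolutelyContinuous (H : IsSeparatingFlow N L G θ t₀) {a b : ℝ} (ha : 0 ≤ a)
    (hab : a ≤ b) : AbsolutelyContinuousOnInterval (fun t => marginLoss G (θ t)) a b :=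
  (H.absolutelyContinuous ha hab).lipschitz_comp
    (locallyLipschitz_marginLoss H.lipschitz).locallyLipschitzOn

theorem norm_absolutelyContinuous (H : IsSeparatingFlow N L G θ t₀) {a b : ℝ} (ha : 0 ≤ a)
    (hab : a ≤ b) : AbsolutelyContinuousOnInterval (fun t => N (θ t)) a b :=
  (H.absolutelyContinuous ha hab).lipschitz_comp
    (locallyLipschitz_seminorm N).locallyLipschitzOn

theorem loss_anti (H : IsSeparatingFlow N L G θ t₀) {a b : ℝ} (ha : 0 ≤ a) (hab : a ≤ b) :
    marginLoss G (θ b) ≤ marginLoss G (θ a) := by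
  have := (H.loss_absolutelyContinuous ha hab).sub_le_mul (c := 0) hab (by
    filter_upwards [H.ae_velocity] with t ht htab
    obtain ⟨v, h, -, -, -, -, hd⟩ := ht (ha.trans htab.1)
    rw [hd.deriv]
    nlinarith [sq_nonneg (speed G θ t)])
  linarith

theorem loss_pos (H : IsSeparatingFlow N L G θ t₀) (w : Vec p) : 0 < marginLoss G w := by
  have : Nonempty (Fin m) := ⟨⟨0, H.nonempty⟩⟩
  exact Finset.sum_pos (fun _ _ => Real.exp_pos _) Finset.univ_nonempty

theorem logLoss_mono (H : IsSeparatingFlow N L G θ t₀) {a b : ℝ} (ha : 0 ≤ a) (hab : a ≤ b) :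
    -Real.log (marginLoss G (θ a)) ≤ -Real.log (marginLoss G (θ b)) :=
  neg_le_neg (Real.log_le_log (H.loss_pos _) (H.loss_anti ha hab))

theorem logLoss_pos (H : IsSeparatingFlow N L G θ t₀) {t : ℝ} (ht : t₀ ≤ t) :
    0 < -Real.log (marginLoss G (θ t)) := by
  have := Real.log_neg (H.loss_pos _) ((H.loss_anti H.time_nonneg ht).trans_lt H.loss_lt)
  linarith

theorem margin_pos (H : IsSeparatingFlow N L G θ t₀) {t : ℝ} (ht : t₀ ≤ t) (i : Fin m) :
    0 < G i (θ t) := (H.logLoss_pos ht).trans_le (neg_log_marginLoss_le i)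

theorem ne_zero (H : IsSeparatingFlow N L G θ t₀) {t : ℝ} (ht : t₀ ≤ t) : θ t ≠ 0 := by
  intro h0
  have h1 := H.margin_pos ht ⟨0, H.nonempty⟩
  have h2 := H.homogeneous ⟨0, H.nonempty⟩ 2 (θ t) two_pos
  rw [h0, smul_zero] at h2
  rw [h0] at h1
  -- Homogeneity with factor 2 forces a margin to vanish at the origin.
  have h3 : (1 : ℝ) < 2 ^ L := Real.one_lt_rpow one_lt_two H.degree_pos
  nlinarith

theorem norm_pos (H : IsSeparatingFlow N L G θ t₀) {t : ℝ} (ht : t₀ ≤ t) : 0 < N (θ t) :=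
  lt_of_le_of_ne (apply_nonneg N _) fun h => H.ne_zero ht (H.definite _ h.symm)

theorem weightedMargin_pos (H : IsSeparatingFlow N L G θ t₀) {t : ℝ} (ht : t₀ ≤ t) :
    0 < weightedMargin G (θ t) :=
  (mul_pos (H.loss_pos _) (H.logLoss_pos ht)).trans_le (marginLoss_mul_le G _)

/-- Euler's identity against the dual norm bound, tested on `θ t` itself. -/
theorem weightedMargin_le_of_abs_inner_le (H : IsSeparatingFlow N L G θ t₀) {t : ℝ}
    {h : Fin m → Vec p} (hh : ∀ i, h i ∈ clarkeSubdiff (G i) (θ t))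
    (hle : ∀ w, |inner ℝ (negGrad G h (θ t)) w| ≤ speed G θ t * N w) :
    L * weightedMargin G (θ t) ≤ speed G θ t * N (θ t) := by
  rw [← inner_negGrad H.lipschitz H.homogeneous hh]
  exact (le_abs_self _).trans (hle _)

theorem logNorm_absolutelyContinuous (H : IsSeparatingFlow N L G θ t₀) {a b : ℝ} (ha : t₀ ≤ a)
    (hab : a ≤ b) : AbsolutelyContinuousOnInterval (fun t => Real.log (N (θ t))) a b := by
  refine (H.norm_absolutelyContinuous (H.time_nonneg.trans ha) hab).contDiffAt_comp
    fun t ht => Real.contDiffAt_log.2 ?_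
  rw [Set.uIcc_of_le hab] at ht
  exact (H.norm_pos (ha.trans ht.1)).ne'

theorem logMargin_absolutelyContinuous (H : IsSeparatingFlow N L G θ t₀) {a b : ℝ} (ha : t₀ ≤ a)
    (hab : a ≤ b) : AbsolutelyContinuousOnInterval (logMargin N L G θ) a b := by
  have h1 := (H.loss_absolutelyContinuous (H.time_nonneg.trans ha) hab).contDiffAt_comp
    (G := fun r => Real.log (-Real.log r)) fun t ht => by
      rw [Set.uIcc_of_le hab] at ht
      exact ((Real.contDiffAt_log.2 (H.loss_pos _).ne').neg).log
        (H.logLoss_pos (ha.trans ht.1)).ne'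
  exact h1.sub ((H.logNorm_absolutelyContinuous ha hab).const_mul L)

theorem ae_norm_differentiable (H : IsSeparatingFlow N L G θ t₀) :
    ∀ᵐ t : ℝ, 0 ≤ t → DifferentiableAt ℝ (fun s => N (θ s)) t := by
  have : ∀ᵐ t : ℝ, ∀ n : ℕ, t ∈ Set.uIcc (0 : ℝ) n → DifferentiableAt ℝ (fun s => N (θ s)) t :=
    ae_all_iff.2 fun n => (H.norm_absolutelyContinuous le_rfl n.cast_nonneg).ae_differentiableAt
  filter_upwards [this] with t ht ht0
  obtain ⟨n, hn⟩ := exists_nat_ge t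
  exact ht n (by rw [Set.uIcc_of_le n.cast_nonneg]; exact ⟨ht0, hn⟩)

/-- The derivative of the radius is at most the speed of the flow. -/
theorem ae_radius (H : IsSeparatingFlow N L G θ t₀) :
    ∀ᵐ t : ℝ, 0 ≤ t → ∃ r : ℝ, HasDerivAt (fun s => N (θ s)) r t ∧ |r| ≤ speed G θ t := by
  filter_upwards [H.ae_velocity, H.ae_norm_differentiable] with t ht hd ht0
  obtain ⟨v, h, hv, hNv, -⟩ := ht ht0
  exact ⟨_, (hd ht0).hasDerivAt, (abs_deriv_seminorm_comp_le hv (hd ht0).hasDerivAt).trans hNv⟩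

/-- The growth of the smoothed margin dominates the misalignment of the flow. -/
theorem ae_le_deriv_logMargin (H : IsSeparatingFlow N L G θ t₀) :
    ∀ᵐ t : ℝ, t₀ ≤ t →
      1 ≤ speed G θ t * N (θ t) / (L * weightedMargin G (θ t)) ∧
      L * (speed G θ t / N (θ t)) *
        (speed G θ t * N (θ t) / (L * weightedMargin G (θ t)) - 1) ≤
          deriv (logMargin N L G θ) t := by
  filter_upwards [H.ae_velocity, H.ae_radius] with t ht hr htt
  obtain ⟨v, h, hv, hNv, hh, hle, hd⟩ := ht (H.time_nonneg.trans htt)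
  obtain ⟨r, hr, hrS⟩ := hr (H.time_nonneg.trans htt)
  have hρ := H.norm_pos htt
  have hΛ := H.logLoss_pos htt
  have hR := H.weightedMargin_pos htt
  have hL := H.degree_pos
  have hℓ := H.loss_pos (θ t)
  have hLR := H.weightedMargin_le_of_abs_inner_le hh hle
  refine ⟨(one_le_div (mul_pos hL hR)).2 hLR, ?_⟩
  have hder : HasDerivAt (logMargin N L G θ)
      (-(-(speed G θ t) ^ 2 / marginLoss G (θ t)) / -Real.log (marginLoss G (θ t)) -
        L * (r / N (θ t))) t :=
    (((hd.log hℓ.ne').neg).log hΛ.ne').sub ((hr.log hρ.ne').const_mul L)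
  rw [hder.deriv]
  set S := speed G θ t
  set ρ := N (θ t)
  set R := weightedMargin G (θ t)
  set ℓ := marginLoss G (θ t)
  set Λ := -Real.log ℓ
  have e1 : L * (S / ρ) * (S * ρ / (L * R) - 1) = S ^ 2 / R - L * (S / ρ) := by
    field_simp
  have e2 : -(-S ^ 2 / ℓ) / Λ = S ^ 2 / (ℓ * Λ) := by
    field_simp
  rw [e1, e2]
  -- Two losses occur: the soft minimum `Λ` is below each margin, so `ℓ * Λ ≤ R`, and the radius
  -- grows no faster than the flow moves.
  have h1 : S ^ 2 / R ≤ S ^ 2 / (ℓ * Λ) :=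
    div_le_div_of_nonneg_left (sq_nonneg S) (mul_pos hℓ hΛ) (marginLoss_mul_le G _)
  have h2 : L * (r / ρ) ≤ L * (S / ρ) := by
    have := (le_abs_self r).trans hrS
    gcongr
  linarith

theorem logMargin_mono (H : IsSeparatingFlow N L G θ t₀) {a b : ℝ} (ha : t₀ ≤ a) (hab : a ≤ b) :
    logMargin N L G θ a ≤ logMargin N L G θ b := by
  have := (H.logMargin_absolutelyContinuous ha hab).integral_le_sub (c := fun _ => 0) hab
    intervalIntegrable_const (by
      filter_upwards [H.ae_le_deriv_logMargin] with t ht htab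
      obtain ⟨h1, h2⟩ := ht (ha.trans htab.1)
      refine le_trans ?_ h2
      have hρ := H.norm_pos (ha.trans htab.1)
      have := speed_nonneg G θ t
      have hL := H.degree_pos
      exact mul_nonneg (by positivity) (by linarith))
  simp at this
  linarith

theorem margin_homogeneous (H : IsSeparatingFlow N L G θ t₀) {t : ℝ} (ht : t₀ ≤ t) (i : Fin m) :
    G i (θ t) = N (θ t) ^ L * G i ((N (θ t))⁻¹ • θ t) := by
  rw [← H.homogeneous i _ _ (H.norm_pos ht), smul_smul, mul_inv_cancel₀ (H.norm_pos ht).ne',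
    one_smul]

theorem exp_logMargin_mul (H : IsSeparatingFlow N L G θ t₀) {t : ℝ} (ht : t₀ ≤ t) :
    Real.exp (logMargin N L G θ t) * N (θ t) ^ L = -Real.log (marginLoss G (θ t)) := by
  rw [logMargin, Real.exp_sub, Real.exp_log (H.logLoss_pos ht), mul_comm L,
    ← Real.rpow_def_of_pos (H.norm_pos ht),
    div_mul_cancel₀ _ (Real.rpow_pos_of_pos (H.norm_pos ht) L).ne']

/-- Monotonicity of the smoothed margin keeps the margins of the normalized direction uniformly away
from 0. -/
theorem exp_logMargin_le (H : IsSeparatingFlow N L G θ t₀) {t : ℝ} (ht : t₀ ≤ t) (i : Fin m) :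
    Real.exp (logMargin N L G θ t₀) ≤ G i ((N (θ t))⁻¹ • θ t) := by
  have h1 := neg_log_marginLoss_le (G := G) (w := θ t) i
  rw [← H.exp_logMargin_mul ht, H.margin_homogeneous ht i, mul_comm] at h1
  exact (Real.exp_le_exp.2 (H.logMargin_mono le_rfl ht)).trans
    (le_of_mul_le_mul_left h1 (Real.rpow_pos_of_pos (H.norm_pos ht) L))

theorem seminorm_direction (H : IsSeparatingFlow N L G θ t₀) {t : ℝ} (ht : t₀ ≤ t) :
    N ((N (θ t))⁻¹ • θ t) = 1 := by
  have := H.norm_pos ht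
  simp [map_smul_eq_mul, abs_of_pos this, this.ne']

/-- The smoothed margin is at most any one normalized margin, which is continuous on the compact
unit sphere. -/
theorem exists_exp_logMargin_le (H : IsSeparatingFlow N L G θ t₀) :
    ∃ M > 0, ∀ t, t₀ ≤ t → Real.exp (logMargin N L G θ t) ≤ M := by
  let i : Fin m := ⟨0, H.nonempty⟩
  obtain ⟨M, hM⟩ := ((isCompact_seminorm_sphere H.definite).image
    (H.lipschitz i).continuous).bddAbove
  refine ⟨max M 1, by positivity, fun t ht => le_max_of_le_left ?_⟩
  have h1 := neg_log_marginLoss_le (G := G) (w := θ t) i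
  rw [← H.exp_logMargin_mul ht, H.margin_homogeneous ht i, mul_comm] at h1
  exact (le_of_mul_le_mul_left h1 (Real.rpow_pos_of_pos (H.norm_pos ht) L)).trans
    (hM ⟨_, H.seminorm_direction ht, rfl⟩)

/-! ### Vanishing of the loss and divergence of the norm. -/

/-- If the loss stayed above `ε`, the increasing smoothed margin would bound the norm by `K`.
Euler's identity would then keep the speed above some `c > 0`, and the loss would fall linearly
below 0. -/
theorem exists_loss_lt (H : IsSeparatingFlow N L G θ t₀) {ε : ℝ} (hε : 0 < ε) :
    ∃ t, t₀ ≤ t ∧ marginLoss G (θ t) < ε := by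
  by_contra! hcon
  set γ := Real.exp (logMargin N L G θ t₀) with hγ
  have hγ0 : 0 < γ := Real.exp_pos _
  have hL := H.degree_pos
  set Λ₀ := -Real.log (marginLoss G (θ t₀)) with hΛ₀
  have hΛ0 : 0 < Λ₀ := H.logLoss_pos le_rfl
  set K := max 1 ((-Real.log ε / γ) ^ L⁻¹) with hK
  have hK0 : 0 < K := lt_of_lt_of_le one_pos (le_max_left _ _)
  have hρ : ∀ t, t₀ ≤ t → N (θ t) ≤ K := by
    intro t ht
    have h1 : γ * N (θ t) ^ L ≤ -Real.log ε := by
      calc γ * N (θ t) ^ L ≤ Real.exp (logMargin N L G θ t) * N (θ t) ^ L :=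
            mul_le_mul_of_nonneg_right (Real.exp_le_exp.2 (H.logMargin_mono le_rfl ht))
              (Real.rpow_nonneg (apply_nonneg N _) L)
        _ = -Real.log (marginLoss G (θ t)) := H.exp_logMargin_mul ht
        _ ≤ -Real.log ε := neg_le_neg (Real.log_le_log hε (hcon t ht))
    have h2 : N (θ t) ^ L ≤ -Real.log ε / γ := by rw [le_div_iff₀ hγ0]; linarith
    have h3 := Real.rpow_le_rpow (Real.rpow_nonneg (apply_nonneg N _) L) h2 (inv_pos.2 hL).le
    rw [Real.rpow_rpow_inv (apply_nonneg N _) hL.ne'] at h3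
    exact h3.trans (le_max_right _ _)
  set c := L * (ε * Λ₀) / K with hc
  have hc0 : 0 < c := by positivity
  have hdec : ∀ b, t₀ ≤ b → marginLoss G (θ b) - marginLoss G (θ t₀) ≤ (b - t₀) * -c ^ 2 := by
    intro b hb
    refine (H.loss_absolutelyContinuous H.time_nonneg hb).sub_le_mul hb ?_
    filter_upwards [H.ae_velocity] with t ht htb
    obtain ⟨v, h, hv, hNv, hh, hle, hd⟩ := ht (H.time_nonneg.trans htb.1)
    rw [hd.deriv, neg_le_neg_iff]
    have hLR := H.weightedMargin_le_of_abs_inner_le hh hle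
    have h1 : ε * Λ₀ ≤ weightedMargin G (θ t) :=
      (mul_le_mul (hcon t htb.1) (H.logLoss_mono H.time_nonneg htb.1) hΛ0.le
        (H.loss_pos _).le).trans (marginLoss_mul_le G _)
    have h2 : c ≤ speed G θ t := by
      rw [hc, div_le_iff₀ hK0]
      calc L * (ε * Λ₀) ≤ L * weightedMargin G (θ t) := by gcongr
        _ ≤ speed G θ t * N (θ t) := hLR
        _ ≤ speed G θ t * K :=
          mul_le_mul_of_nonneg_left (hρ t htb.1) (speed_nonneg G θ t)
    exact pow_le_pow_left₀ hc0.le h2 2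
  -- After time `1 / c ^ 2` the loss would have dropped by at least 1, although it started below 1.
  have h1 := hdec (t₀ + (c ^ 2)⁻¹) (by have := inv_pos.2 (pow_pos hc0 2); linarith)
  have h2 := H.loss_pos (θ (t₀ + (c ^ 2)⁻¹))
  have h3 := H.loss_lt
  have h4 : (t₀ + (c ^ 2)⁻¹ - t₀) * -c ^ 2 = -1 := by field_simp; ring
  linarith

/-- `-log loss` is at most `M * N (θ t) ^ L`, so its divergence forces that of the norm. -/
theorem tendsto_norm_atTop (H : IsSeparatingFlow N L G θ t₀) :
    Tendsto (fun t => N (θ t)) atTop atTop := by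
  obtain ⟨M, hM, hle⟩ := H.exists_exp_logMargin_le
  have hL := H.degree_pos
  rw [tendsto_atTop]
  intro K
  set K' := max K 1 with hK'
  have hK0 : 0 < K' := lt_of_lt_of_le one_pos (le_max_right _ _)
  obtain ⟨T, hT, hlt⟩ := H.exists_loss_lt (Real.exp_pos (-(M * K' ^ L)))
  filter_upwards [eventually_ge_atTop T] with t ht
  have htt := hT.trans ht
  have h1 : M * K' ^ L ≤ -Real.log (marginLoss G (θ t)) := by
    have h2 := (H.loss_anti (H.time_nonneg.trans hT) ht).trans hlt.le
    have h3 := Real.log_le_log (H.loss_pos _) h2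
    rw [Real.log_exp] at h3
    linarith
  rw [← H.exp_logMargin_mul htt] at h1
  have h4 : M * K' ^ L ≤ M * N (θ t) ^ L :=
    h1.trans (mul_le_mul_of_nonneg_right (hle t htt) (Real.rpow_nonneg (apply_nonneg N _) L))
  have h5 := le_of_mul_le_mul_left h4 hM
  exact (le_max_left K 1).trans
    ((Real.rpow_le_rpow_iff hK0.le (apply_nonneg N _) hL).1 h5)

/-! ### Logarithmic length and the motion of the direction. -/

theorem speed_div_intervalIntegrable (H : IsSeparatingFlow N L G θ t₀) {a b : ℝ} (ha : t₀ ≤ a)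
    (hab : a ≤ b) : IntervalIntegrable (fun t => speed G θ t / N (θ t)) volume a b := by
  have hd := (H.loss_absolutelyContinuous (H.time_nonneg.trans ha) hab).intervalIntegrable_deriv
  have hS : IntervalIntegrable (speed G θ) volume a b := by
    -- The square root of the decay rate is dominated by 1 plus the absolute derivative of the loss.
    refine (intervalIntegrable_const (c := (1 : ℝ)).add hd.norm).mono_fun ?_ ?_
    · exact ((measurable_deriv _).neg.sqrt).aestronglyMeasurable
    · refine Eventually.of_forall fun t => ?_
      change ‖speed G θ t‖ ≤ ‖1 + ‖deriv (fun s => marginLoss G (θ s)) t‖‖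
      rw [Real.norm_of_nonneg (speed_nonneg G θ t)]
      have h0 := norm_nonneg (deriv (fun s => marginLoss G (θ s)) t)
      rw [Real.norm_of_nonneg (by positivity), speed]
      refine Real.sqrt_le_iff.2 ⟨by positivity, ?_⟩
      have := neg_abs_le (deriv (fun s => marginLoss G (θ s)) t)
      rw [Real.norm_eq_abs] at h0 ⊢
      nlinarith
  have hc : ContinuousOn (fun t => (N (θ t))⁻¹) (Set.uIcc a b) := by
    refine (H.norm_absolutelyContinuous (H.time_nonneg.trans ha) hab).continuousOn.inv₀ ?_
    intro t ht
    rw [Set.uIcc_of_le hab] at ht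
    exact (H.norm_pos (ha.trans ht.1)).ne'
  simpa [div_eq_mul_inv] using hS.mul_continuousOn hc

theorem logNorm_sub_le (H : IsSeparatingFlow N L G θ t₀) {a b : ℝ} (ha : t₀ ≤ a) (hab : a ≤ b) :
    Real.log (N (θ b)) - Real.log (N (θ a)) ≤ ∫ t in a..b, speed G θ t / N (θ t) := by
  refine (H.logNorm_absolutelyContinuous ha hab).sub_le_integral hab
    (H.speed_div_intervalIntegrable ha hab) ?_
  filter_upwards [H.ae_radius] with t ht htab
  have hρ := H.norm_pos (ha.trans htab.1)
  obtain ⟨r, hr, hrS⟩ := ht (H.time_nonneg.trans (ha.trans htab.1))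
  rw [(hr.log hρ.ne').deriv]
  have := (le_abs_self r).trans hrS
  gcongr

/-- The factor 2 counts the velocity term and the change of the normalizing radius, each at most
`speed / N`. -/
theorem direction_sub_le (H : IsSeparatingFlow N L G θ t₀) {a b : ℝ} (ha : t₀ ≤ a) (hab : a ≤ b) :
    N ((N (θ b))⁻¹ • θ b - (N (θ a))⁻¹ • θ a) ≤ 2 * ∫ t in a..b, speed G θ t / N (θ t) := by
  have hinv : AbsolutelyContinuousOnInterval (fun t => (N (θ t))⁻¹) a b := by
    refine (H.norm_absolutelyContinuous (H.time_nonneg.trans ha) hab).contDiffAt_comp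
      (G := fun r => r⁻¹) fun t ht => contDiffAt_inv ℝ ?_
    rw [Set.uIcc_of_le hab] at ht
    exact (H.norm_pos (ha.trans ht.1)).ne'
  have hdir : AbsolutelyContinuousOnInterval
      (fun t => N ((N (θ t))⁻¹ • θ t - (N (θ a))⁻¹ • θ a)) a b := by
    have h1 := hinv.smul (H.absolutelyContinuous (H.time_nonneg.trans ha) hab)
    have hlip : LocallyLipschitz fun w : Vec p => N (w - (N (θ a))⁻¹ • θ a) :=
      (locallyLipschitz_seminorm N).comp
        (ContDiff.locallyLipschitz (𝕂 := ℝ) (f := fun w : Vec p => w - (N (θ a))⁻¹ • θ a)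
          (by fun_prop))
    exact h1.lipschitz_comp (G := fun w : Vec p => N (w - (N (θ a))⁻¹ • θ a))
      hlip.locallyLipschitzOn
  have := hdir.sub_le_integral hab (c := fun t => 2 * (speed G θ t / N (θ t)))
    ((H.speed_div_intervalIntegrable ha hab).const_mul 2) (by
      filter_upwards [H.ae_velocity, H.ae_radius, hdir.ae_differentiableAt] with t ht hr hd htab
      have htt := ha.trans htab.1
      have hρ := H.norm_pos htt
      obtain ⟨v, h, hv, hNv, -⟩ := ht (H.time_nonneg.trans htt)
      obtain ⟨r, hr, hrS⟩ := hr (H.time_nonneg.trans htt)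
      have hd' := (hd (by rwa [Set.uIcc_of_le hab])).hasDerivAt
      have hw : HasDerivAt (fun s => (N (θ s))⁻¹ • θ s - (N (θ a))⁻¹ • θ a)
          ((N (θ t))⁻¹ • v + (-r / N (θ t) ^ 2) • θ t) t :=
        ((hr.inv hρ.ne').smul hv).sub_const _
      refine (le_abs_self _).trans ((abs_deriv_seminorm_comp_le hw hd').trans ?_)
      refine (map_add_le_add N _ _).trans ?_
      rw [map_smul_eq_mul, map_smul_eq_mul, norm_inv, Real.norm_of_nonneg hρ.le, norm_div,
        norm_neg, norm_pow, Real.norm_of_nonneg hρ.le, Real.norm_eq_abs]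
      have e1 : (N (θ t))⁻¹ * N v ≤ speed G θ t / N (θ t) := by
        rw [inv_mul_eq_div]; gcongr
      have e2 : |r| / N (θ t) ^ 2 * N (θ t) ≤ speed G θ t / N (θ t) := by
        have : |r| / N (θ t) ^ 2 * N (θ t) = |r| / N (θ t) := by field_simp
        rw [this]; gcongr
      linarith)
  rw [intervalIntegral.integral_const_mul] at this
  simpa using this

end IsSeparatingFlow

/-! ### Times of near alignment. -/

namespace IsSeparatingFlow

variable {N : Seminorm ℝ (Vec p)} {L : ℝ} {G : Fin m → Vec p → ℝ} {θ : ℝ → Vec p} {t₀ : ℝ}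

theorem exists_logMargin_sub_lt (H : IsSeparatingFlow N L G θ t₀) {ε : ℝ} (hε : 0 < ε) :
    ∃ T, t₀ ≤ T ∧ ∀ a b, T ≤ a → T ≤ b → logMargin N L G θ b - logMargin N L G θ a < ε := by
  obtain ⟨M, hM, hle⟩ := H.exists_exp_logMargin_le
  have hbdd : BddAbove (logMargin N L G θ '' Set.Ici t₀) := by
    refine ⟨Real.log M, ?_⟩
    rintro _ ⟨t, ht, rfl⟩
    exact (Real.le_log_iff_exp_le hM).2 (hle t ht)
  have hne : (logMargin N L G θ '' Set.Ici t₀).Nonempty := ⟨_, t₀, Set.self_mem_Ici, rfl⟩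
  obtain ⟨_, ⟨T, hT, rfl⟩, hlt⟩ := exists_lt_of_lt_csSup hne
    (sub_lt_self (sSup (logMargin N L G θ '' Set.Ici t₀)) hε)
  have hT : t₀ ≤ T := hT
  refine ⟨T, hT, fun a b ha hb => ?_⟩
  have h1 := H.logMargin_mono hT ha
  have h2 : logMargin N L G θ b ≤ sSup (logMargin N L G θ '' Set.Ici t₀) :=
    le_csSup hbdd ⟨b, hT.trans hb, rfl⟩
  linarith

/-- Near a limit direction there are arbitrarily late times at which the negative subgradient is
almost aligned with the parameters. -/
theorem exists_aligned_time (H : IsSeparatingFlow N L G θ t₀) {θbar : Vec p}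
    (hbar : MapClusterPt θbar atTop (fun t : ℝ => (N (θ t))⁻¹ • θ t)) {P : ℝ → Prop}
    (hP : ∀ᵐ t : ℝ, 0 ≤ t → P t) {η : ℝ} (hη : 0 < η) (T : ℝ) :
    ∃ t, T ≤ t ∧ t₀ ≤ t ∧ P t ∧ N ((N (θ t))⁻¹ • θ t - θbar) ≤ 3 * η ∧
      speed G θ t * N (θ t) / (L * weightedMargin G (θ t)) < 1 + η := by
  have hL := H.degree_pos
  have hNc := (locallyLipschitz_seminorm N).continuous
  -- Misalignment by `η` throughout a window of logarithmic length `η` would raise `logMargin` by `L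
  -- * η * η`, which this choice of `T'` excludes.
  obtain ⟨T', hT', hΦ⟩ := H.exists_logMargin_sub_lt (ε := L * η * η) (by positivity)
  have hnhds : {w : Vec p | N (w - θbar) < η} ∈ 𝓝 θbar :=
    (isOpen_lt (hNc.comp (by fun_prop)) continuous_const).mem_nhds (by simpa using hη)
  obtain ⟨a, hadir, ha⟩ := ((mapClusterPt_iff_frequently.1 hbar _ hnhds).and_eventually
    (eventually_ge_atTop (max T T'))).exists
  have hadir : N ((N (θ a))⁻¹ • θ a - θbar) < η := hadir
  have haT' : T' ≤ a := (le_max_right _ _).trans ha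
  have hat : t₀ ≤ a := hT'.trans haT'
  -- Growth of the norm by a factor `exp η` needs logarithmic length at least `η`; the intermediate
  -- value theorem then cuts the window to length exactly `η`.
  obtain ⟨b₀, hb₀, hab₀⟩ := ((H.tendsto_norm_atTop.eventually_ge_atTop
    (N (θ a) * Real.exp η)).and (eventually_ge_atTop a)).exists
  have hlog : η ≤ ∫ t in a..b₀, speed G θ t / N (θ t) := by
    refine le_trans ?_ (H.logNorm_sub_le hat hab₀)
    have h1 := Real.log_le_log (by have := H.norm_pos hat; positivity) hb₀
    rw [Real.log_mul (H.norm_pos hat).ne' (Real.exp_pos _).ne', Real.log_exp] at h1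
    linarith
  have hint := H.speed_div_intervalIntegrable hat hab₀
  have hcont : ContinuousOn (fun s => ∫ t in a..s, speed G θ t / N (θ t)) (Set.Icc a b₀) := by
    have := intervalIntegral.continuousOn_primitive_interval' hint Set.left_mem_uIcc
    rwa [Set.uIcc_of_le hab₀] at this
  obtain ⟨b, hb, hbη⟩ := intermediate_value_Icc hab₀ hcont
    (show η ∈ Set.Icc _ _ from ⟨by simpa using hη.le, hlog⟩)
  have hbη : ∫ t in a..b, speed G θ t / N (θ t) = η := hbη
  have hex : ∃ t ∈ Set.Icc a b, P t ∧
      speed G θ t * N (θ t) / (L * weightedMargin G (θ t)) < 1 + η := by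
    by_contra! hcon
    have hI := H.speed_div_intervalIntegrable hat hb.1
    have h1 := (H.logMargin_absolutelyContinuous hat hb.1).integral_le_sub hb.1
      (c := fun t => L * η * (speed G θ t / N (θ t))) (hI.const_mul _) (by
        filter_upwards [hP, H.ae_le_deriv_logMargin] with t hPt ht htab
        have htt := hat.trans htab.1
        refine le_trans ?_ (ht htt).2
        have h2 := hcon t htab (hPt (H.time_nonneg.trans htt))
        have h3 : 0 ≤ L * (speed G θ t / N (θ t)) :=
          mul_nonneg hL.le (div_nonneg (speed_nonneg G θ t) (apply_nonneg N _))
        nlinarith)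
    rw [intervalIntegral.integral_const_mul, hbη] at h1
    exact absurd h1 (not_le.2 (hΦ a b haT' (haT'.trans hb.1)))
  obtain ⟨t, ht, hPt, hκ⟩ := hex
  refine ⟨t, (le_max_left _ _).trans (ha.trans ht.1), hat.trans ht.1, hPt, ?_, hκ⟩
  -- The distance `3 * η` is `η` at time `a` plus at most `2 * η` of motion inside the window.
  have h1 := H.direction_sub_le hat ht.1
  have h2 : ∫ s in a..t, speed G θ s / N (θ s) ≤ η := by
    rw [← hbη]
    refine intervalIntegral.integral_mono_interval le_rfl ht.1 ht.2 ?_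
      (H.speed_div_intervalIntegrable hat hb.1)
    exact Eventually.of_forall fun s => div_nonneg (speed_nonneg G θ s) (apply_nonneg N _)
  have h3 := map_add_le_add N ((N (θ t))⁻¹ • θ t - (N (θ a))⁻¹ • θ a)
    ((N (θ a))⁻¹ • θ a - θbar)
  rw [sub_add_sub_cancel] at h3
  linarith

end IsSeparatingFlow

/-! ### Scaling of subgradients. -/

/-- Clarke subgradients of a homogeneous function of degree `L` are homogeneous of degree
`L - 1`. -/
theorem exists_smul_of_mem_clarkeSubdiff_homogeneous {f : Vec p → ℝ} {L : ℝ}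
    (hhom : IsHomogeneousOfDegree L f) {c : ℝ} (hc : 0 < c)
    {w g : Vec p} (hg : g ∈ clarkeSubdiff f w) :
    ∃ h ∈ clarkeSubdiff f (c • w), g = (c ^ (1 - L)) • h := by
  have hcL := Real.rpow_pos_of_pos hc L
  refine exists_smul_of_gradient_eq (φ := fun u => c • u) (a := fun _ => c ^ (1 - L))
    (by fun_prop) continuousAt_const (Real.rpow_pos_of_pos hc _).ne' (fun u hu => ?_) hg
  have hd : DifferentiableAt ℝ f (c • u) := by
    have h1 : DifferentiableAt ℝ (fun w => c ^ L * f (c⁻¹ • w)) (c • u) := by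
      refine DifferentiableAt.const_mul ?_ _
      refine DifferentiableAt.comp (c • u) (f := fun w : Vec p => c⁻¹ • w) ?_ (by fun_prop)
      rwa [smul_smul, inv_mul_cancel₀ hc.ne', one_smul]
    refine h1.congr_of_eventuallyEq (Eventually.of_forall fun w => ?_)
    change f w = c ^ L * f (c⁻¹ • w)
    rw [← hhom c _ hc, smul_smul, mul_inv_cancel₀ hc.ne', one_smul]
  refine ⟨hd, ?_⟩
  have h2 : HasDerivAt (fun r : ℝ => (c ^ L)⁻¹ * r) (c ^ L)⁻¹ (f (c • u)) := by
    simpa using (hasDerivAt_id (f (c • u))).const_mul (c ^ L)⁻¹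
  have h3 := (hasGradientAt_comp_smul hd h2).gradient
  have e1 : (fun w => (c ^ L)⁻¹ * f (c • w)) = f := by
    ext w
    rw [hhom c w hc, inv_mul_cancel_left₀ hcL.ne']
  rw [e1] at h3
  rw [h3, Real.rpow_sub hc, Real.rpow_one, div_eq_inv_mul]

/-- The transfer lemma is applied from `f` to `α + β * f`, hence its factor is `β⁻¹`. It serves the
constraint functions and the signs of the labels. -/
theorem exists_of_mem_clarkeSubdiff_affine {f : Vec p → ℝ} {α β : ℝ} (hβ : β ≠ 0)
    {w g : Vec p} (hg : g ∈ clarkeSubdiff f w) :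
    ∃ h ∈ clarkeSubdiff (fun u => α + β * f u) w, h = β • g := by
  obtain ⟨h, hh, e⟩ := exists_smul_of_gradient_eq (F := f) (f := fun u => α + β * f u)
    (φ := fun u => u) (a := fun _ => β⁻¹) continuousAt_id continuousAt_const (inv_ne_zero hβ)
    (fun u hu => by
      refine ⟨(hu.const_mul β).const_add α, ?_⟩
      have h2 : HasDerivAt (fun r : ℝ => α + β * r) β (f ((1 : ℝ) • u)) := by
        simpa using ((hasDerivAt_id (f u)).const_mul β).const_add α
      have h3 := (hasGradientAt_comp_smul (c := 1) (u := u) (by simpa using hu) h2).gradient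
      simp only [one_smul, mul_one] at h3
      rw [h3, smul_smul, inv_mul_cancel₀ hβ, one_smul]) hg
  exact ⟨h, hh, by rw [e, smul_smul, mul_inv_cancel₀ hβ, one_smul]⟩

/-! ### Approximate multipliers and their limit. -/

namespace IsSeparatingFlow

variable {N : Seminorm ℝ (Vec p)} {L : ℝ} {G : Fin m → Vec p → ℝ} {θ : ℝ → Vec p} {t₀ : ℝ}

/-- Near a limit direction there are arbitrarily late times at which the KKT conditions hold
approximately. -/
theorem exists_approximate_multipliers (H : IsSeparatingFlow N L G θ t₀) {θbar : Vec p}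
    (hbar : MapClusterPt θbar atTop (fun t : ℝ => (N (θ t))⁻¹ • θ t)) {η : ℝ} (hη : 0 < η)
    (T : ℝ) :
    ∃ t, T ≤ t ∧ t₀ ≤ t ∧ N ((N (θ t))⁻¹ • θ t - θbar) ≤ 3 * η ∧
      ∃ (a : Fin m → ℝ) (h : Fin m → Vec p),
        (∀ i, a i ∈ Set.Icc 0 (L * Real.exp (logMargin N L G θ t₀))⁻¹) ∧
        (∀ i, h i ∈ clarkeSubdiff (G i) ((N (θ t))⁻¹ • θ t)) ∧
        (∀ w, inner ℝ (∑ i, a i • h i) w ≤ N w) ∧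
        (1 + η)⁻¹ ≤ inner ℝ (∑ i, a i • h i) ((N (θ t))⁻¹ • θ t) ∧
        ∀ i j, a i = Real.exp (-(N (θ t) ^ L *
          (G i ((N (θ t))⁻¹ • θ t) - G j ((N (θ t))⁻¹ • θ t)))) * a j := by
  obtain ⟨t, hTt, htt, ⟨v, h, -, -, hh, hle, -⟩, hdir, hκ⟩ :=
    H.exists_aligned_time hbar H.ae_velocity hη T
  refine ⟨t, hTt, htt, hdir, ?_⟩
  have hρ := H.norm_pos htt
  have hL := H.degree_pos
  have hR := H.weightedMargin_pos htt
  have hLR := H.weightedMargin_le_of_abs_inner_le hh hle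
  have hS : 0 < speed G θ t := by
    by_contra hcon
    have : speed G θ t = 0 := le_antisymm (not_lt.1 hcon) (speed_nonneg G θ t)
    rw [this, zero_mul] at hLR
    nlinarith [mul_pos hL hR]
  choose h' hh' heq using fun i => exists_smul_of_mem_clarkeSubdiff_homogeneous
    (H.homogeneous i) (inv_pos.2 hρ) (hh i)
  set S := speed G θ t with hSdef
  set ρ := N (θ t) with hρdef
  -- Dividing by the speed brings the dual norm to at most 1; the power of `ρ⁻¹` comes from moving
  -- the subgradients to the normalized direction.
  set a : Fin m → ℝ := fun i => S⁻¹ * (Real.exp (-(G i (θ t))) * ρ⁻¹ ^ (1 - L)) with ha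
  have hpow : 0 < ρ⁻¹ ^ (1 - L) := Real.rpow_pos_of_pos (inv_pos.2 hρ) _
  have hz : ∑ i, a i • h' i = S⁻¹ • negGrad G h (θ t) := by
    rw [negGrad, Finset.smul_sum]
    refine Finset.sum_congr rfl fun i _ => ?_
    rw [heq i, smul_smul, smul_smul, ha, mul_assoc]
  refine ⟨a, h', fun i => ⟨?_, ?_⟩, hh', fun w => ?_, ?_, fun i j => ?_⟩
  · have := Real.exp_pos (-(G i (θ t)))
    rw [ha]; positivity
  -- A single term satisfies `E * G i ≤ R ≤ S * ρ / L`, while `G i ≥ ρ ^ L * γ`; the powers of `ρ`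
  -- cancel.
  · have hγ := Real.exp_pos (logMargin N L G θ t₀)
    have h1 : Real.exp (-(G i (θ t))) * G i (θ t) ≤ weightedMargin G (θ t) :=
      Finset.single_le_sum (f := fun i => Real.exp (-(G i (θ t))) * G i (θ t))
        (fun j _ => mul_nonneg (Real.exp_pos _).le (H.margin_pos htt j).le) (Finset.mem_univ i)
    have h2 : ρ ^ L * Real.exp (logMargin N L G θ t₀) ≤ G i (θ t) := by
      rw [H.margin_homogeneous htt i]
      exact mul_le_mul_of_nonneg_left (H.exp_logMargin_le htt i)
        (Real.rpow_pos_of_pos hρ L).le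
    have hE := Real.exp_pos (-(G i (θ t)))
    set E := Real.exp (-(G i (θ t))) with hEdef
    set γ := Real.exp (logMargin N L G θ t₀)
    have e1 : ρ⁻¹ ^ (1 - L) = ρ ^ L / ρ := by
      rw [Real.inv_rpow hρ.le, ← Real.rpow_neg hρ.le, neg_sub, Real.rpow_sub hρ, Real.rpow_one]
    have h3 : L * (E * (ρ ^ L * γ)) ≤ S * ρ :=
      (mul_le_mul_of_nonneg_left ((mul_le_mul_of_nonneg_left h2 hE.le).trans h1) hL.le).trans hLR
    rw [ha]
    simp only
    rw [e1, ← one_div (L * γ), le_div_iff₀ (mul_pos hL hγ)]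
    have e2 : S⁻¹ * (E * (ρ ^ L / ρ)) * (L * γ) = L * (E * (ρ ^ L * γ)) / (S * ρ) := by
      field_simp
    rw [e2, div_le_one (mul_pos hS hρ)]
    exact h3
  · rw [hz, inner_smul_left]
    simp only [conj_trivial]
    rw [inv_mul_le_iff₀ hS]
    exact (le_abs_self _).trans (hle w)
  -- By Euler's identity this pairing is the reciprocal of the alignment ratio.
  · rw [hz, inner_smul_left, inner_smul_right, inner_negGrad H.lipschitz H.homogeneous hh]
    simp only [conj_trivial]
    have hκ0 : 0 < S * ρ / (L * weightedMargin G (θ t)) := by positivity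
    have := inv_anti₀ hκ0 hκ.le
    refine this.trans (le_of_eq ?_)
    rw [inv_div]; field_simp
  · have e1 : -(G i (θ t)) = -(ρ ^ L * (G i (ρ⁻¹ • θ t) - G j (ρ⁻¹ • θ t))) + -(G j (θ t)) := by
      rw [H.margin_homogeneous htt i, H.margin_homogeneous htt j]
      ring
    rw [ha]
    simp only
    rw [e1, Real.exp_add]
    ring

/-- The directional form of the KKT conditions at a limit direction of a separating steepest
flow. -/
theorem exists_multipliers (H : IsSeparatingFlow N L G θ t₀) {θbar : Vec p}
    (hbar : MapClusterPt θbar atTop (fun t : ℝ => (N (θ t))⁻¹ • θ t)) :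
    N θbar = 1 ∧ (∀ i, 0 < G i θbar) ∧
      ∃ (a : Fin m → ℝ) (h : Fin m → Vec p), (∀ i, 0 ≤ a i) ∧
        (∀ i, h i ∈ clarkeSubdiff (G i) θbar) ∧ (∀ w, inner ℝ (∑ i, a i • h i) w ≤ N w) ∧
        1 ≤ inner ℝ (∑ i, a i • h i) θbar ∧ ∀ i j, G j θbar < G i θbar → a i = 0 := by
  have hNc := (locallyLipschitz_seminorm N).continuous
  -- Tolerance `1 / (k + 1)` at times past `k`, so both errors vanish and the norm diverges along `t
  -- k`.
  choose t htk htt hdir a h ha hh hw hin hexp using fun k : ℕ =>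
    H.exists_approximate_multipliers hbar (η := 1 / ((k : ℝ) + 1)) (by positivity) k
  set u : ℕ → Vec p := fun k => (N (θ (t k)))⁻¹ • θ (t k) with hu
  have hη : Tendsto (fun k : ℕ => 1 / ((k : ℝ) + 1)) atTop (𝓝 0) :=
    tendsto_one_div_add_atTop_nhds_zero_nat
  have hulim : Tendsto u atTop (𝓝 θbar) := by
    obtain ⟨c, hc, hcle⟩ := exists_pos_mul_norm_le H.definite
    rw [tendsto_iff_norm_sub_tendsto_zero]
    have hub : Tendsto (fun k : ℕ => c⁻¹ * (3 * (1 / ((k : ℝ) + 1)))) atTop (𝓝 0) := by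
      simpa using (hη.const_mul 3).const_mul c⁻¹
    refine squeeze_zero (fun _ => norm_nonneg _) (fun k => ?_) hub
    rw [le_inv_mul_iff₀ hc]
    exact (hcle _).trans (hdir k)
  have htlim : Tendsto t atTop atTop :=
    tendsto_atTop_mono htk tendsto_natCast_atTop_atTop
  have hρlim : Tendsto (fun k => N (θ (t k)) ^ L) atTop atTop :=
    (tendsto_rpow_atTop H.degree_pos).comp (H.tendsto_norm_atTop.comp htlim)
  have hNbar : N θbar = 1 := by
    refine tendsto_nhds_unique ((hNc.tendsto θbar).comp hulim) ?_
    refine tendsto_const_nhds.congr fun k => ?_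
    exact (H.seminorm_direction (htt k)).symm
  have hGlim : ∀ i, Tendsto (fun k => G i (u k)) atTop (𝓝 (G i θbar)) := fun i =>
    ((H.lipschitz i).continuous.tendsto θbar).comp hulim
  have hpos : ∀ i, 0 < G i θbar := fun i =>
    (Real.exp_pos _).trans_le (ge_of_tendsto' (hGlim i) fun k => H.exp_logMargin_le (htt k) i)
  refine ⟨hNbar, hpos, ?_⟩
  -- Multipliers and subgradients are bounded along the sequence, so a subsequence converges.
  choose K hK using fun i => exists_eventually_clarkeSubdiff_subset (H.lipschitz i) θbar
  have hcomp : IsCompact ((Set.univ.pi fun _ : Fin m =>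
      Set.Icc (0 : ℝ) (L * Real.exp (logMargin N L G θ t₀))⁻¹) ×ˢ
      (Set.univ.pi fun i : Fin m => Metric.closedBall (0 : Vec p) (K i))) :=
    (isCompact_univ_pi fun _ => isCompact_Icc).prod
      (isCompact_univ_pi fun i => isCompact_closedBall 0 (K i))
  have hev : ∀ᶠ k in atTop, (a k, h k) ∈ ((Set.univ.pi fun _ : Fin m =>
      Set.Icc (0 : ℝ) (L * Real.exp (logMargin N L G θ t₀))⁻¹) ×ˢ
      (Set.univ.pi fun i : Fin m => Metric.closedBall (0 : Vec p) (K i))) := by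
    filter_upwards [hulim.eventually (eventually_all.2 hK)] with k hk
    exact ⟨fun i _ => ha k i, fun i _ => hk i (hh k i)⟩
  obtain ⟨⟨A, B⟩, -, φ, hφ, hlim⟩ := hcomp.tendsto_subseq' hev.frequently
  have hφt := hφ.tendsto_atTop
  have hA : Tendsto (fun k => a (φ k)) atTop (𝓝 A) := (continuous_fst.tendsto _).comp hlim
  have hB : Tendsto (fun k => h (φ k)) atTop (𝓝 B) := (continuous_snd.tendsto _).comp hlim
  have hAi : ∀ i, Tendsto (fun k => a (φ k) i) atTop (𝓝 (A i)) := tendsto_pi_nhds.1 hA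
  have hBi : ∀ i, Tendsto (fun k => h (φ k) i) atTop (𝓝 (B i)) := tendsto_pi_nhds.1 hB
  have hz : Tendsto (fun k => ∑ i, a (φ k) i • h (φ k) i) atTop (𝓝 (∑ i, A i • B i)) :=
    tendsto_finsetSum _ fun i _ => (hAi i).smul (hBi i)
  have huφ : Tendsto (fun k => u (φ k)) atTop (𝓝 θbar) := hulim.comp hφt
  refine ⟨A, B, fun i => ge_of_tendsto' (hAi i) fun k => (ha _ i).1, fun i =>
    mem_clarkeSubdiff_of_tendsto (H.lipschitz i) huφ (hBi i) fun k => hh _ i, fun w => ?_, ?_, ?_⟩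
  · have h1 : Tendsto (fun k => inner ℝ (∑ i, a (φ k) i • h (φ k) i) w) atTop
        (𝓝 (inner ℝ (∑ i, A i • B i) w)) := hz.inner tendsto_const_nhds
    exact le_of_tendsto' h1 fun k => hw _ w
  · have h1 : Tendsto (fun k => inner ℝ (∑ i, a (φ k) i • h (φ k) i) (u (φ k))) atTop
        (𝓝 (inner ℝ (∑ i, A i • B i) θbar)) := hz.inner huφ
    have h2 : Tendsto (fun k : ℕ => (1 + 1 / ((φ k : ℝ) + 1))⁻¹) atTop (𝓝 1) := by
      have := ((hη.comp hφt).const_add 1).inv₀ (by norm_num)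
      simpa using this
    exact le_of_tendsto_of_tendsto' h2 h1 fun k => hin _
  · intro i j hij
    -- The gap of margins tends to a positive limit and is multiplied by `ρ ^ L → ∞`, so the weight
    -- of `i` relative to `j` tends to 0.
    have h1 : Tendsto (fun k => Real.exp (-(N (θ (t (φ k))) ^ L *
        (G i (u (φ k)) - G j (u (φ k))))) * a (φ k) j) atTop (𝓝 (0 * A j)) := by
      refine Tendsto.mul ?_ (hAi j)
      refine Real.tendsto_exp_neg_atTop_nhds_zero.comp ?_
      exact (hρlim.comp hφt).atTop_mul_pos (sub_pos.2 hij)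
        (((hGlim i).comp hφt).sub ((hGlim j).comp hφt))
    rw [zero_mul] at h1
    exact tendsto_nhds_unique (hAi i) (h1.congr fun k => (hexp (φ k) i j).symm)

end IsSeparatingFlow

/-! ### From the limit direction to the KKT point. -/

theorem locallyLipschitz_half_sq (N : Seminorm ℝ (Vec p)) :
    LocallyLipschitz fun w => (1 / 2 : ℝ) * N w ^ 2 :=
  (ContDiff.locallyLipschitz (𝕂 := ℝ) (f := fun r : ℝ => (1 / 2 : ℝ) * r ^ 2)
    (by fun_prop)).comp (locallyLipschitz_seminorm N)

/-- A norming functional of a unit vector scales to a subgradient of half the squared norm. -/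
theorem smul_mem_clarkeSubdiff_half_sq {N : Seminorm ℝ (Vec p)} {w z : Vec p} {c : ℝ}
    (hc : 0 ≤ c) (hw : N w = 1) (hz : ∀ v, inner ℝ z v ≤ N v) (hzw : 1 ≤ inner ℝ z w) :
    c • z ∈ clarkeSubdiff (fun v => (1 / 2 : ℝ) * N v ^ 2) (c • w) := by
  refine mem_clarkeSubdiff_of_subgradient (locallyLipschitz_half_sq N) fun v => ?_
  rw [map_smul_eq_mul, hw, Real.norm_of_nonneg hc, inner_smul_left, inner_sub_right,
    inner_smul_right]
  simp only [conj_trivial]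
  -- The claim reduces to `c * N v - c ^ 2 / 2 ≤ N v ^ 2 / 2`, a perfect square.
  have h1 := mul_le_mul_of_nonneg_left (hz v) hc
  have h2 := mul_le_mul_of_nonneg_left hzw (mul_nonneg hc hc)
  nlinarith [sq_nonneg (N v - c)]

theorem AdmitsChainRule.const_mul {F : Vec p → ℝ} (hF : AdmitsChainRule F) {β : ℝ}
    (hβ : β ≠ 0) : AdmitsChainRule fun w => β * F w := by
  intro u hu
  filter_upwards [hF u hu] with t ht ht0 g hg
  obtain ⟨h, hh, e⟩ := exists_of_mem_clarkeSubdiff_affine (α := 0) (inv_ne_zero hβ) hg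
  simp only [zero_add, inv_mul_cancel_left₀ hβ] at hh
  have h1 := (ht ht0 h hh).const_mul β
  have e2 : β * inner ℝ h (deriv u t) = inner ℝ g (deriv u t) := by
    rw [e, inner_smul_left]
    simp [hβ]
  rwa [e2] at h1

end SteepestFlow

theorem theorem2 {d p m : ℕ} (hm : 0 < m)
    (x : Fin m → Vec d) (y : Fin m → ℝ) (hy : ∀ i, y i = 1 ∨ y i = -1)
    (f : Vec d → Vec p → ℝ) (L : ℝ) (hL : 0 < L)
    (hLip : ∀ i, LocallyLipschitz (f (x i)))
    (hChain : ∀ i, AdmitsChainRule (f (x i)))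
    (hHom : ∀ i, IsHomogeneousOfDegree L (f (x i)))
    (N : Seminorm ℝ (Vec p)) (hN : ∀ w, N w = 0 → w = 0)
    (θ : ℝ → Vec p) (hflow : IsSteepestFlow N (expLoss f x y) θ)
    (hreal : ∃ t₀ : ℝ, 0 < t₀ ∧ expLoss f x y (θ t₀) < 1)
    (θbar : Vec p) (hbar : MapClusterPt θbar atTop (fun t : ℝ => (N (θ t))⁻¹ • θ t)) :
    ∃ c : ℝ, 0 < c ∧ IsKKTPoint N f x y (c • θbar) := by
  obtain ⟨t₀, ht₀, hlt⟩ := hreal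
  have hy0 : ∀ i, y i ≠ 0 := fun i => by rcases hy i with h | h <;> rw [h] <;> norm_num
  set G : Fin m → Vec p → ℝ := fun i w => y i * f (x i) w with hG
  have hGhom : ∀ i, IsHomogeneousOfDegree L (G i) := fun i c w hc => by
    simp only [hG]
    rw [hHom i c w hc]; ring
  have H : IsSeparatingFlow N L G θ t₀ :=
    { nonempty := hm
      definite := hN
      degree_pos := hL
      lipschitz := fun i => (ContDiff.locallyLipschitz (𝕂 := ℝ) (f := fun r : ℝ => y i * r)
        (by fun_prop)).comp (hLip i)
      chainRule := fun i => (hChain i).const_mul (hy0 i)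
      homogeneous := hGhom
      flow := hflow
      time_nonneg := ht₀.le
      loss_lt := hlt }
  obtain ⟨hNbar, hpos, a, h, ha, hh, hz, hz1, hcs⟩ := H.exists_multipliers hbar
  have : Nonempty (Fin m) := ⟨⟨0, hm⟩⟩
  obtain ⟨j, hj⟩ := Finite.exists_min fun i => G i θbar
  set γ := G j θbar with hγ
  have hγ0 : 0 < γ := hpos j
  -- This scale makes the smallest margin exactly 1, as `c ^ L = γ⁻¹`.
  set c := γ⁻¹ ^ L⁻¹ with hc
  have hc0 : 0 < c := Real.rpow_pos_of_pos (inv_pos.2 hγ0) _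
  have hcL : c ^ L = γ⁻¹ := Real.rpow_inv_rpow (inv_pos.2 hγ0).le hL.ne'
  have hGc : ∀ i, y i * f (x i) (c • θbar) = γ⁻¹ * G i θbar := fun i => by
    rw [← hcL]; exact hGhom i c θbar hc0
  choose h₁ hh₁ heq₁ using fun i =>
    exists_smul_of_mem_clarkeSubdiff_homogeneous (hGhom i) hc0 (hh i)
  choose h₂ hh₂ heq₂ using fun i =>
    exists_of_mem_clarkeSubdiff_affine (α := 1) (β := -1) (by norm_num) (hh₁ i)
  -- In the multipliers, `c` comes from the subgradient of the half squared norm at `c • θbar`, and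
  -- `c ^ (1 - L)` from moving the margin subgradients there from `θbar`.
  refine ⟨c, hc0, fun i => ?_, fun i => c * a i * c ^ (1 - L), fun i => ?_,
    ⟨c • ∑ i, a i • h i, smul_mem_clarkeSubdiff_half_sq hc0.le hNbar hz hz1, h₂, fun i => ?_, ?_⟩,
    fun i => ?_⟩
  · rw [hGc, inv_mul_eq_div, le_div_iff₀ hγ0, one_mul]
    exact hj i
  · exact mul_nonneg (mul_nonneg hc0.le (ha i)) (Real.rpow_pos_of_pos hc0 _).le
  · have := hh₂ i
    simpa [hG, sub_eq_add_neg] using this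
  · rw [Finset.smul_sum, ← Finset.sum_add_distrib]
    refine Finset.sum_eq_zero fun i _ => ?_
    rw [heq₁ i, heq₂ i]
    module
  -- Either the margin is minimal and its constraint is tight, or its multiplier vanishes.
  · rcases (hj i).eq_or_lt with e | hlt
    · rw [hGc, ← e, inv_mul_cancel₀ hγ0.ne']; simp
    · simp [hcs i j hlt]
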